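/- Let $n\ge 0$ and let $|\nu\rangle=|\nu_1,\dots,\nu_n\rangle$, $\nu\in\mathbb Z_+^n$, be the number basis of $\bigotimes_{j=1}^n\ell_2\cong\ell^2(\mathbb Z_+^n)$. Let $\hat a_i|\nu\rangle=\sqrt{\nu_i}\,|\nu-e_i\rangle$, $\hat a_i^\dagger|\nu\rangle=\sqrt{\nu_i+1}\,|\nu+e_i\rangle$, and $\mathfrak a=(\hat a_1,\dots,\hat a_n,\hat a_1^\dagger,\dots,\hat a_n^\dagger)^T$. For $f\in\mathbb C^{2n}$ and $K\in\mathbb C^{2n\times 2n}$ put $f^T\mathfrak a=\sum_k f_k\mathfrak a_k$ and $\mathfrak a^TK\mathfrak a=\sum_{k,l}K_{kl}\mathfrak a_k\mathfrak a_l$. Let $$J=\begin{pmatrix}0&-I_n\\ I_n&0\end{pmatrix},\qquad E=\begin{pmatrix}0&I_n\\ I_n&0\end{pmatrix},\qquad \tilde g=E\overline g,\qquad \tilde K=E\overline KE .$$ For $t\ge 0$ let $H_t,\Gamma_t\in\mathbb C^{2n\times2n}$ and $f_t\in\mathbb C^{2n}$ be continuous in $t$, with $H_t=H_t^T=\tilde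 H_t$, $\Gamma_t^T=\tilde\Gamma_t$, $\Gamma_tE\ge 0$ and $f_t=\tilde f_t$, and let $$\mathcal L_{H,\Gamma,f}(\rho)=-i\Big[\tfrac12\mathfrak a^TH\mathfrak a+f^T\mathfrak a,\rho\Big]+\sum_{k,l}\Gamma_{kl}\,\mathfrak a_k\rho\,\mathfrak a_l-\tfrac12\,\mathfrak a^T\Gamma^T\mathfrak a\,\rho-\tfrac12\,\rho\,\mathfrak a^T\Gamma^T\mathfrak a .$$ Let $(\rho_t)_{t\ge0}$ be density matrices (non-negative self-adjoint operators of trace one) which satisfy $$\frac{d}{dt}\rho_t=\mathcal L_{H_t,\Gamma_t,f_t}(\rho_t),\qquad t\ge 0,$$ at least in the weak sense: for all finite linear combinations $\varphi,\psi$ of number states the function $t\mapsto\langle\varphi,\rho_t\psi\rangle$ is differentiable on $[0,\infty)$ (one-sidedly at $0$) with derivative $\langle\varphi,\mathcal L_{H_t,\Gamma_t,f_t}(\rho_t)\psi\rangle$, where $\langle\varphi,A\rho B\psi\rangle$ means $\langle A^\dagger\varphi,\rho B\psi\rangle$ for polynomials $A,B$ in the $\mathfrak a_k$. Suppose that for every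 $t\ge0$ the mean vector and the matrix of second central moments $$m_t=\mathrm{tr}\,(\mathfrak a\,\rho_t),\qquad D_t=\mathrm{tr}\,\big((\mathfrak a-m_t)(\mathfrak a-m_t)^T\rho_t\big)$$ are finite, that is, that the series $\mathrm{tr}\,(A\rho_t)=\sum_\nu\langle A^\dagger\nu,\rho_t\,\nu\rangle$ defining their entries converge absolutely. Then $m_t$ and $D_t$ are differentiable on $[0,\infty)$ (one-sidedly at $0$) and, for all $t\ge 0$, $$\frac{d}{dt}m_t=J\Big(iH_t+\frac{\Gamma_t^T-\Gamma_t}2\Big)m_t+iJf_t,$$ $$\frac{d}{dt}D_t=J\Big(iH_t+\frac{\Gamma_t^T-\Gamma_t}2\Big)D_t+D_t\Big(-iH_t+\frac{\Gamma_t^T-\Gamma_t}2\Big)J+J\Gamma_t^TJ .$$ -/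

import Mathlib

open scoped ComplexConjugate ComplexOrder

noncomputable section

namespace BosonicGKSL

/-- The `n`-mode bosonic Hilbert space `ℓ² ⊗ ⋯ ⊗ ℓ²`, realised as `ℓ²(ℕⁿ)`: its canonical
orthonormal basis is that of the number states `|ν₁, …, νₙ⟩`. -/
abbrev FockSpace (n : ℕ) : Type := lp (fun _ : Fin n → ℕ => ℂ) 2

/-- The finite linear combinations of number states. -/
abbrev FiniteVec (n : ℕ) : Type := (Fin n → ℕ) →₀ ℂ

/-- The number state `|ν⟩`. -/
def numberState {n : ℕ} (ν : Fin n → ℕ) : FiniteVec n := Finsupp.single ν 1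

/-- The inclusion of the finite linear combinations of number states in the Hilbert space. -/
def incl (n : ℕ) : FiniteVec n →ₗ[ℂ] FockSpace n :=
  Finsupp.linearCombination ℂ (fun ν : Fin n → ℕ => lp.single 2 ν (1 : ℂ))

/-- The annihilation operator: `a_i |ν⟩ = √ν_i |ν - e_i⟩` (which is `0` if `ν_i = 0`). -/
def annihilation {n : ℕ} (i : Fin n) : FiniteVec n →ₗ[ℂ] FiniteVec n :=
  Finsupp.linearCombination ℂ
    (fun ν : Fin n → ℕ => ((√(ν i : ℝ) : ℝ) : ℂ) • numberState (ν - Pi.single i 1))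

/-- The creation operator: `a_i† |ν⟩ = √(ν_i + 1) |ν + e_i⟩`. -/
def creation {n : ℕ} (i : Fin n) : FiniteVec n →ₗ[ℂ] FiniteVec n :=
  Finsupp.linearCombination ℂ
    (fun ν : Fin n → ℕ => ((√((ν i : ℝ) + 1) : ℝ) : ℂ) • numberState (ν + Pi.single i 1))

/-- The index set of the `2n`-vector `𝔞 = (a_1, …, a_n, a_1†, …, a_n†)`. -/
abbrev Idx (n : ℕ) : Type := Fin n ⊕ Fin n

/-- The entries of the vector `𝔞 = (a_1, …, a_n, a_1†, …, a_n†)`. -/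
def ladder {n : ℕ} : Idx n → FiniteVec n →ₗ[ℂ] FiniteVec n :=
  Sum.elim annihilation creation

/-- Sesquilinear forms (conjugate linear in the first variable) on the finite vectors. An operator
`A` gives the form `(φ, ψ) ↦ ⟪φ, A ψ⟫`; expressions such as `a_k a_l ρ`, `a_k ρ a_l`, with `ρ`
bounded and the `a_k` unbounded, always make sense as forms. -/
abbrev Form (n : ℕ) : Type := FiniteVec n →ₗ⋆[ℂ] FiniteVec n →ₗ[ℂ] ℂ

/-- The form `(φ, ψ) ↦ ⟪φ, ρ ψ⟫` of a bounded operator. -/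
def toForm {n : ℕ} (ρ : FockSpace n →L[ℂ] FockSpace n) : Form n :=
  ((innerₛₗ ℂ : FockSpace n →ₗ⋆[ℂ] FockSpace n →ₗ[ℂ] ℂ).comp (incl n)).compl₂
    (ρ.toLinearMap ∘ₗ incl n)

theorem toForm_apply {n : ℕ} (ρ : FockSpace n →L[ℂ] FockSpace n) (φ ψ : FiniteVec n) :
    toForm ρ φ ψ = inner ℂ (incl n φ) (ρ (incl n ψ)) := rfl

theorem inner_numberState {n : ℕ} (μ ν : Fin n → ℕ) :
    inner ℂ (incl n (numberState μ)) (incl n (numberState ν)) = if μ = ν then (1 : ℂ) else 0 := by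
  simp only [incl, numberState, Finsupp.linearCombination_single, one_smul]
  rw [lp.inner_single_left, lp.single_apply]
  by_cases h : μ = ν
  · subst h; simp
  · simp [h]

theorem ladder_inl {n : ℕ} (i : Fin n) (ν : Fin n → ℕ) :
    ladder (Sum.inl i) (numberState ν)
      = ((√(ν i : ℝ) : ℝ) : ℂ) • numberState (ν - Pi.single i 1) := by
  simp [ladder, annihilation, numberState]

theorem ladder_inr {n : ℕ} (i : Fin n) (ν : Fin n → ℕ) :
    ladder (Sum.inr i) (numberState ν)
      = ((√((ν i : ℝ) + 1) : ℝ) : ℂ) • numberState (ν + Pi.single i 1) := by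
  simp [ladder, creation, numberState]

theorem inner_ladder_aux {n : ℕ} (i : Fin n) (μ ν : Fin n → ℕ) :
    inner ℂ (incl n (ladder (Sum.inl i) (numberState μ))) (incl n (numberState ν))
      = inner ℂ (incl n (numberState μ)) (incl n (ladder (Sum.inr i) (numberState ν))) := by
  rw [ladder_inl, ladder_inr, map_smul, map_smul, inner_smul_left, inner_smul_right,
    inner_numberState, inner_numberState, Complex.conj_ofReal]
  by_cases h : μ = ν + Pi.single i 1
  · subst h
    simp
  · rw [if_neg h, mul_zero]
    by_cases h0 : μ i = 0
    · simp [h0]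
    · rw [if_neg, mul_zero]
      rintro rfl
      apply h
      ext j
      by_cases hj : j = i
      · subst hj; simp; omega
      · simp [hj]

/-- `⟪𝔞_k φ, ψ⟫ = ⟪φ, 𝔞_k† ψ⟫`, where `𝔞_k†` is the entry of `𝔞` with the index `k.swap`. -/
theorem inner_ladder {n : ℕ} (k : Idx n) (φ ψ : FiniteVec n) :
    inner ℂ (incl n (ladder k φ)) (incl n ψ)
      = inner ℂ (incl n φ) (incl n (ladder k.swap ψ)) := by
  induction φ using Finsupp.induction_linear with
  | zero => simp
  | add φ₁ φ₂ h₁ h₂ => simp only [map_add, inner_add_left, h₁, h₂]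
  | single μ c =>
    induction ψ using Finsupp.induction_linear with
    | zero => simp
    | add ψ₁ ψ₂ h₁ h₂ => simp only [map_add, inner_add_right, h₁, h₂]
    | single ν d =>
      have hμ : (Finsupp.single μ c : FiniteVec n) = c • numberState μ := by simp [numberState]
      have hν : (Finsupp.single ν d : FiniteVec n) = d • numberState ν := by simp [numberState]
      rw [hμ, hν]
      simp only [map_smul, inner_smul_left, inner_smul_right]
      congr 2
      rcases k with i | i
      · exact inner_ladder_aux i μ ν
      · rw [← inner_conj_symm, ← inner_conj_symm (incl n (numberState μ))]
        exact congrArg _ (inner_ladder_aux i ν μ).symm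

/-- `ρ ↦ 𝔞_k ρ`, that is `(φ, ψ) ↦ ⟪𝔞_k† φ, ρ ψ⟫`; the adjoint of `𝔞_k` is the entry of `𝔞` with
the index `k.swap`, see `inner_ladder`. -/
def leftMul {n : ℕ} (k : Idx n) (σ : Form n) : Form n := σ.comp (ladder k.swap)

/-- `ρ ↦ ρ 𝔞_k`, that is `(φ, ψ) ↦ ⟪φ, ρ 𝔞_k ψ⟫`. -/
def rightMul {n : ℕ} (k : Idx n) (σ : Form n) : Form n := σ.compl₂ (ladder k)

/-- `(fᵀ𝔞) ρ`. -/
def leftLin {n : ℕ} (f : Idx n → ℂ) (σ : Form n) : Form n := ∑ k, f k • leftMul k σ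

/-- `ρ (fᵀ𝔞)`. -/
def rightLin {n : ℕ} (f : Idx n → ℂ) (σ : Form n) : Form n := ∑ k, f k • rightMul k σ

/-- `(𝔞ᵀ K 𝔞) ρ = ∑ K_{kl} 𝔞_k 𝔞_l ρ`. -/
def leftQuad {n : ℕ} (K : Matrix (Idx n) (Idx n) ℂ) (σ : Form n) : Form n :=
  ∑ k, ∑ l, K k l • leftMul k (leftMul l σ)

/-- `ρ (𝔞ᵀ K 𝔞) = ∑ K_{kl} ρ 𝔞_k 𝔞_l`. -/
def rightQuad {n : ℕ} (K : Matrix (Idx n) (Idx n) ℂ) (σ : Form n) : Form n :=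
  ∑ k, ∑ l, K k l • rightMul l (rightMul k σ)

/-- `𝔞ᵀ ρ Γ 𝔞 = ∑ Γ_{kl} 𝔞_k ρ 𝔞_l`. -/
def sandwich {n : ℕ} (Γ : Matrix (Idx n) (Idx n) ℂ) (σ : Form n) : Form n :=
  ∑ k, ∑ l, Γ k l • leftMul k (rightMul l σ)

/-- The quadratic generator
`L_{H,Γ,f}(ρ) = -i[½ 𝔞ᵀH𝔞 + fᵀ𝔞, ρ] + 𝔞ᵀρΓ𝔞 - ½ 𝔞ᵀΓᵀ𝔞 ρ - ½ ρ 𝔞ᵀΓᵀ𝔞`. -/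
def generator {n : ℕ} (H Γ : Matrix (Idx n) (Idx n) ℂ) (f : Idx n → ℂ) (σ : Form n) : Form n :=
  -Complex.I • (((1 / 2 : ℂ) • leftQuad H σ + leftLin f σ)
      - ((1 / 2 : ℂ) • rightQuad H σ + rightLin f σ))
    + sandwich Γ σ - (1 / 2 : ℂ) • leftQuad Γ.transpose σ - (1 / 2 : ℂ) • rightQuad Γ.transpose σ

/-- The matrix `E = (0, I; I, 0)`. The matrix `J = (0, -I; I, 0)` is Mathlib's `Matrix.J`. -/
def E (n : ℕ) : Matrix (Idx n) (Idx n) ℂ := Matrix.fromBlocks 0 1 1 0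

/-- The conjugation `g ↦ E ḡ` of vectors. -/
def vecTilde {n : ℕ} (g : Idx n → ℂ) : Idx n → ℂ := (E n).mulVec (fun k => conj (g k))

/-- The conjugation `K ↦ E K̄ E` of matrices. -/
def matTilde {n : ℕ} (K : Matrix (Idx n) (Idx n) ℂ) : Matrix (Idx n) (Idx n) ℂ :=
  E n * K.map conj * E n

/-- The conditions on the coefficients under which `L_{H,Γ,f}` is a quadratic GKSL generator. -/
structure IsGKSLCoeff {n : ℕ} (H Γ : Matrix (Idx n) (Idx n) ℂ) (f : Idx n → ℂ) : Prop where
  H_symm : H.transpose = H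
  H_tilde : matTilde H = H
  Γ_tilde : Γ.transpose = matTilde Γ
  Γ_nonneg : (Γ * E n).PosSemidef
  f_tilde : vecTilde f = f

/-- `c = tr σ = ∑_ν ⟨ν|σ|ν⟩`, where the series over the number states converges absolutely. -/
def HasTrace {n : ℕ} (σ : Form n) (c : ℂ) : Prop :=
  HasSum (fun ν : Fin n → ℕ => σ (numberState ν) (numberState ν)) c

/-- A density matrix: a non-negative self-adjoint operator of trace one. -/
structure IsDensity {n : ℕ} (ρ : FockSpace n →L[ℂ] FockSpace n) : Prop where
  pos : ρ.IsPositive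
  trace_one : HasTrace (toForm ρ) 1

/-- `ρ_t` is differentiable and `dρ_t/dt = L_{H_t,Γ_t,f_t}(ρ_t)` for all `t ≥ 0`, in the weak sense,
that is between arbitrary finite linear combinations of number states. -/
def IsSolution {n : ℕ} (H Γ : ℝ → Matrix (Idx n) (Idx n) ℂ) (f : ℝ → Idx n → ℂ)
    (ρ : ℝ → FockSpace n →L[ℂ] FockSpace n) : Prop :=
  ∀ t : ℝ, 0 ≤ t → ∀ φ ψ : FiniteVec n,
    HasDerivWithinAt (fun s => toForm (ρ s) φ ψ)
      (generator (H t) (Γ t) (f t) (toForm (ρ t)) φ ψ) (Set.Ici 0) t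

/-- The first moments of `ρ` are finite and `m = tr (𝔞 ρ)`. -/
def IsMean {n : ℕ} (ρ : FockSpace n →L[ℂ] FockSpace n) (m : Idx n → ℂ) : Prop :=
  ∀ k, HasTrace (leftMul k (toForm ρ)) (m k)

/-- `ρ ↦ (𝔞_k - m_k) ρ`. -/
def centredMul {n : ℕ} (m : Idx n → ℂ) (k : Idx n) (σ : Form n) : Form n :=
  leftMul k σ - m k • σ

/-- The second moments of `ρ` about `m` are finite and `D = tr ((𝔞 - m)(𝔞 - m)ᵀ ρ)`. -/
def IsSecondCentral {n : ℕ} (ρ : FockSpace n →L[ℂ] FockSpace n) (m : Idx n → ℂ)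
    (D : Matrix (Idx n) (Idx n) ℂ) : Prop :=
  ∀ k l, HasTrace (centredMul m k (centredMul m l (toForm ρ))) (D k l)

end BosonicGKSL

end

noncomputable section

namespace BosonicGKSL

/-! Formally, the derivative of `tr (Aρ)` is `tr (A L(ρ))`. Cyclicity of the trace brings every
ladder operator to the left of `ρ`, and the canonical commutation relations then leave words no
longer than `A`. The difficulty is analytic: `L(ρ)` is only a form, the words that should cancel
have up to four letters and need not have a trace, and the second moments are finite at each time
with no local bound given.

The remedy is to work with `tr (χ(N) w ρ)`, where `w` is a word in the ladder operators and `χ` a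
finitely supported function of the total number `N`. This is a finite sum of matrix elements, so the
weak equation differentiates it exactly. Cyclicity now costs only a shift of `χ`
(`cutTrace_rightMul`). The generator therefore produces words longer than `w`, weighted by
differences of `χ` and its shifts, and commutator terms no longer than `w`. A word of `d` letters
grows like `N^(d/2)`, and positivity of `ρ` bounds its matrix elements by populations. So if the
differences of `χ` are `O(1/N)`, even four letters are controlled by the energy `tr ((N + 1)ρ)`.

Two families of cut-offs are used. For `logWeight c - 1` the differences multiplied by `N` are
bounded by the weight itself, so Gronwall's inequality closes uniformly in `c` and gives a local
bound on the energy (`IsSolution.exists_energy_le`). The cut-offs `linCutoff R` tend to one; with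
the energy bound, dominated convergence removes the long words, and the limiting identities hold
after integration in time (`BoundedLimit.hasDerivWithinAt`). What remains is matrix algebra
(`coeffSum_one`, `coeffSum_two`) and the passage from the second moments `M` to `D = M - m mᵀ`. -/

/-- The total number of quanta of a number state. -/
def total {n : ℕ} (ν : Fin n → ℕ) : ℕ := ∑ i, ν i

/-! ### Ladder operators on number states. -/

/-- The label of the number state to which the ladder operator `k` sends `|ν⟩`. -/
def step {n : ℕ} (k : Idx n) (ν : Fin n → ℕ) : Fin n → ℕ :=
  k.elim (fun i => ν - Pi.single i 1) (fun i => ν + Pi.single i 1)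

/-- The amplitude with which the ladder operator `k` acts on `|ν⟩`. -/
def amp {n : ℕ} (k : Idx n) (ν : Fin n → ℕ) : ℝ :=
  k.elim (fun i => √(ν i : ℝ)) (fun i => √((ν i : ℝ) + 1))

theorem ladder_numberState {n : ℕ} (k : Idx n) (ν : Fin n → ℕ) :
    ladder k (numberState ν) = (amp k ν : ℂ) • numberState (step k ν) := by
  rcases k with i | i
  · exact ladder_inl i ν
  · exact ladder_inr i ν

theorem total_add_single {n : ℕ} (i : Fin n) (ν : Fin n → ℕ) :
    total (ν + Pi.single i 1) = total ν + 1 := by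
  simp [total, Finset.sum_add_distrib]

theorem apply_le_total {n : ℕ} (i : Fin n) (ν : Fin n → ℕ) : ν i ≤ total ν :=
  Finset.single_le_sum (f := ν) (fun _ _ => Nat.zero_le _) (Finset.mem_univ i)

theorem add_single_injective {n : ℕ} (i : Fin n) :
    Function.Injective (fun ν : Fin n → ℕ => ν + Pi.single i 1) :=
  add_left_injective _

theorem sub_single_add_single {n : ℕ} {i : Fin n} {ν : Fin n → ℕ} (h : ν i ≠ 0) :
    ν - Pi.single i 1 + Pi.single i 1 = ν := by
  ext j
  by_cases hj : j = i
  · subst hj; simp; omega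
  · simp [hj]

theorem add_single_apply_of_ne {n : ℕ} {i j : Fin n} (ν : Fin n → ℕ) (h : i ≠ j) :
    (ν + Pi.single j 1 : Fin n → ℕ) i = ν i := by
  simp [h]

theorem sub_single_apply_of_ne {n : ℕ} {i j : Fin n} (ν : Fin n → ℕ) (h : i ≠ j) :
    (ν - Pi.single j 1 : Fin n → ℕ) i = ν i := by
  simp [h]

theorem amp_nonneg {n : ℕ} (k : Idx n) (ν : Fin n → ℕ) : 0 ≤ amp k ν := by
  rcases k with i | i <;> exact Real.sqrt_nonneg _

theorem amp_le {n : ℕ} (k : Idx n) (ν : Fin n → ℕ) : amp k ν ≤ √((total ν : ℝ) + 1) := by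
  rcases k with i | i <;> refine Real.sqrt_le_sqrt ?_ <;>
    have h : (ν i : ℝ) ≤ total ν := by exact_mod_cast apply_le_total i ν
  · linarith
  · linarith

theorem total_step_le {n : ℕ} (k : Idx n) (ν : Fin n → ℕ) : total (step k ν) ≤ total ν + 1 := by
  rcases k with i | i
  · refine le_trans (Finset.sum_le_sum fun j _ => ?_) (Nat.le_succ _)
    exact Nat.sub_le _ _
  · exact (total_add_single i ν).le

/-- The change of argument of a function of the number operator when it is moved to the left of
the ladder operator `k`. -/
def shiftNat {n : ℕ} (k : Idx n) (z : ℕ) : ℕ := k.elim (fun _ => z + 1) (fun _ => z - 1)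

/-! ### Cut-off traces and cyclicity. -/

/-- The finitely supported functions of the total number. -/
def Cutoff : Submodule ℂ (ℕ → ℂ) where
  carrier := {χ | ∃ R : ℕ, ∀ z, R ≤ z → χ z = 0}
  zero_mem' := ⟨0, fun _ _ => rfl⟩
  add_mem' := by
    rintro χ η ⟨R, hR⟩ ⟨S, hS⟩
    exact ⟨max R S, fun z hz => by simp [hR z (by omega), hS z (by omega)]⟩
  smul_mem' := by
    rintro c χ ⟨R, hR⟩
    exact ⟨R, fun z hz => by simp [hR z hz]⟩

/-- `χ(N) ↦ 𝔞_k χ(N) 𝔞_k⁻¹` on finitely supported functions of the total number. -/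
def shift {n : ℕ} (k : Idx n) : Cutoff →ₗ[ℂ] Cutoff where
  toFun χ := ⟨fun z => (χ : ℕ → ℂ) (shiftNat k z), by
    obtain ⟨χ, R, hR⟩ := χ
    refine ⟨R + 1, fun z hz => hR _ ?_⟩
    rcases k with i | i <;> simp [shiftNat] <;> omega⟩
  map_add' _ _ := rfl
  map_smul' _ _ := rfl

theorem finite_total_lt (n R : ℕ) : {ν : Fin n → ℕ | total ν < R}.Finite :=
  (Set.finite_Iic (fun _ : Fin n => R)).subset fun ν hν i =>
    (apply_le_total i ν).trans (le_of_lt hν)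

theorem summable_cutoff {n : ℕ} (χ : Cutoff) (v : (Fin n → ℕ) → ℂ) :
    Summable fun ν => (χ : ℕ → ℂ) (total ν) * v ν := by
  obtain ⟨χ, R, hR⟩ := χ
  refine summable_of_hasFiniteSupport ((finite_total_lt n R).subset fun ν hν => ?_)
  by_contra h
  exact hν (by simp [hR _ (not_lt.1 h)])

/-- The trace `tr (χ(N) τ)` of a form that is cut off by a finitely supported function of the total
number. -/
def cutTrace (n : ℕ) : Cutoff →ₗ[ℂ] Form n →ₗ[ℂ] ℂ :=
  LinearMap.mk₂ ℂ
    (fun χ τ => ∑' ν : Fin n → ℕ, (χ : ℕ → ℂ) (total ν) * τ (numberState ν) (numberState ν))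
    (fun χ η τ => by
      rw [← (summable_cutoff χ _).tsum_add (summable_cutoff η _)]
      simp [add_mul])
    (fun c χ τ => by simp [mul_assoc, tsum_mul_left])
    (fun χ τ υ => by
      rw [← (summable_cutoff χ _).tsum_add (summable_cutoff χ _)]
      simp [mul_add])
    (fun c χ τ => by simp [mul_left_comm, tsum_mul_left])

theorem cutTrace_apply {n : ℕ} (χ : Cutoff) (τ : Form n) :
    cutTrace n χ τ
      = ∑' ν : Fin n → ℕ, (χ : ℕ → ℂ) (total ν) * τ (numberState ν) (numberState ν) := rfl

theorem leftMul_numberState {n : ℕ} (k : Idx n) (τ : Form n) (ν : Fin n → ℕ) (ψ : FiniteVec n) :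
    leftMul k τ (numberState ν) ψ
      = (amp k.swap ν : ℂ) * τ (numberState (step k.swap ν)) ψ := by
  simp only [leftMul, LinearMap.comp_apply, ladder_numberState, LinearMap.map_smulₛₗ,
    LinearMap.smul_apply, smul_eq_mul, Complex.conj_ofReal]

theorem rightMul_numberState {n : ℕ} (k : Idx n) (τ : Form n) (φ : FiniteVec n) (ν : Fin n → ℕ) :
    rightMul k τ φ (numberState ν)
      = (amp k ν : ℂ) * τ φ (numberState (step k ν)) := by
  simp [rightMul, ladder_numberState]

/-- Cyclicity of the trace. -/
theorem cutTrace_rightMul {n : ℕ} (χ : Cutoff) (k : Idx n) (τ : Form n) :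
    cutTrace n χ (rightMul k τ) = cutTrace n (shift k χ) (leftMul k τ) := by
  simp only [cutTrace_apply, leftMul_numberState, rightMul_numberState]
  rcases k with i | i
  -- One of the two sums is reindexed along `ν ↦ ν + e_i`. Labels outside the range have `ν i = 0`,
  -- and there the annihilation amplitude vanishes.
  · rw [← (add_single_injective i).tsum_eq]
    · refine tsum_congr fun ν => ?_
      simp [amp, step, shift, shiftNat, total_add_single]
    · intro ν hν
      have h : ν i ≠ 0 := by
        rintro h
        simp [amp, h] at hν
      exact ⟨_, sub_single_add_single h⟩
  · symm
    rw [← (add_single_injective i).tsum_eq]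
    · refine tsum_congr fun ν => ?_
      simp [amp, step, shift, shiftNat, total_add_single]
    · intro ν hν
      have h : ν i ≠ 0 := by
        rintro h
        simp [amp, h] at hν
      exact ⟨_, sub_single_add_single h⟩

theorem leftMul_rightMul {n : ℕ} (k l : Idx n) (τ : Form n) :
    leftMul k (rightMul l τ) = rightMul l (leftMul k τ) := rfl

theorem ext_numberState {n : ℕ} {σ τ : Form n}
    (h : ∀ μ ν, σ (numberState μ) (numberState ν) = τ (numberState μ) (numberState ν)) :
    σ = τ := by
  ext μ ν
  exact h μ ν

/-! ### Canonical commutation relations. -/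

theorem ladder_ladder {n : ℕ} (k l : Idx n) (ν : Fin n → ℕ) :
    ladder k (ladder l (numberState ν))
      = ladder l (ladder k (numberState ν)) + (Matrix.J (Fin n) ℂ l k) • numberState ν := by
  have key : ∀ i j : Fin n, ladder (Sum.inl i) (ladder (Sum.inr j) (numberState ν))
      = ladder (Sum.inr j) (ladder (Sum.inl i) (numberState ν))
        + (if i = j then (1 : ℂ) else 0) • numberState ν := by
    intro i j
    simp only [ladder_numberState, map_smul, smul_smul, ← Complex.ofReal_mul]
    by_cases h : i = j
    · subst h
      -- Subtraction of labels is truncated, so lowering and then raising restores `ν` only when `ν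
      -- i ≠ 0`. Otherwise the amplitude is zero.
      by_cases h0 : ν i = 0
      · simp [amp, step, h0]
      · simp only [amp, step, Sum.elim_inl, Sum.elim_inr, add_tsub_cancel_right,
          sub_single_add_single h0, if_true, ← add_smul]
        congr 1
        norm_cast
        have h1 : (ν - Pi.single i 1 : Fin n → ℕ) i + 1 = ν i := by simp; omega
        have h2 : (ν + Pi.single i 1 : Fin n → ℕ) i = ν i + 1 := by simp
        rw [h1, h2, Real.mul_self_sqrt (by positivity), Real.mul_self_sqrt (by positivity)]
        push_cast
        ring
    · have h' : j ≠ i := fun h' => h h'.symm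
      rw [if_neg h, zero_smul, add_zero]
      have h1 := add_single_apply_of_ne ν h
      have h2 := sub_single_apply_of_ne ν h'
      by_cases h0 : ν i = 0
      · simp [amp, step, h0, h]
      · simp only [amp, step, Sum.elim_inl, Sum.elim_inr, h1, h2]
        rw [mul_comm]
        congr 2
        refine funext fun a => ?_
        by_cases ha : a = i
        · subst ha; simp [h]
        · simp [ha]
  rcases k with i | i <;> rcases l with j | j
  · simp only [ladder_numberState, map_smul, smul_smul, ← Complex.ofReal_mul]
    by_cases h : i = j
    · subst h; simp [Matrix.J]
    · have h' : j ≠ i := fun h' => h h'.symm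
      have h1 := sub_single_apply_of_ne ν h
      have h2 := sub_single_apply_of_ne ν h'
      simp only [amp, step, Sum.elim_inl, h1, h2, Matrix.J, Matrix.fromBlocks_apply₁₁,
        Matrix.zero_apply, zero_smul, add_zero]
      rw [mul_comm, tsub_right_comm]
  · rw [key]
    simp [Matrix.J, Matrix.one_apply, eq_comm]
  · rw [key, add_assoc, ← add_smul]
    by_cases h : j = i
    · simp [Matrix.J, h]
    · simp [Matrix.J, h]
  · simp only [ladder_numberState, map_smul, smul_smul, ← Complex.ofReal_mul]
    by_cases h : i = j
    · subst h; simp [Matrix.J]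
    · have h' : j ≠ i := fun h' => h h'.symm
      have h1 := add_single_apply_of_ne ν h
      have h2 := add_single_apply_of_ne ν h'
      simp only [amp, step, Sum.elim_inr, h1, h2, Matrix.J, Matrix.fromBlocks_apply₂₂,
        Matrix.zero_apply, zero_smul, add_zero]
      rw [mul_comm, add_right_comm]

/-- Left multiplication acts through adjoints on the conjugate linear variable: the order of the
factors is reversed, indices are swapped and scalars are conjugated. The commutator must survive all
three. -/
theorem conj_J_swap {n : ℕ} (k l : Idx n) :
    conj (Matrix.J (Fin n) ℂ k.swap l.swap) = Matrix.J (Fin n) ℂ l k := by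
  rcases k with i | i <;> rcases l with j | j <;> simp [Matrix.J, Matrix.one_apply, eq_comm]

/-- The canonical commutation relations. -/
theorem leftMul_leftMul {n : ℕ} (k l : Idx n) (τ : Form n) :
    leftMul k (leftMul l τ) = leftMul l (leftMul k τ) + (Matrix.J (Fin n) ℂ l k) • τ := by
  refine ext_numberState fun μ ν => ?_
  have h := ladder_ladder l.swap k.swap μ
  simp only [leftMul, LinearMap.comp_apply, LinearMap.add_apply, LinearMap.smul_apply, smul_eq_mul]
  rw [h, map_add, LinearMap.add_apply, LinearMap.map_smulₛₗ, LinearMap.smul_apply, smul_eq_mul]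
  rw [conj_J_swap]

/-! ### Words in the ladder operators and their bounds by populations. -/

/-- `leftMul k` as a linear map. -/
def leftMulLin {n : ℕ} (k : Idx n) : Module.End ℂ (Form n) where
  toFun := leftMul k
  map_add' _ _ := rfl
  map_smul' _ _ := rfl

/-- Left multiplication by a product of ladder operators. -/
def word {n : ℕ} (w : List (Idx n)) : Module.End ℂ (Form n) := (w.map leftMulLin).prod

theorem word_nil {n : ℕ} (σ : Form n) : word [] σ = σ := rfl

theorem word_cons {n : ℕ} (k : Idx n) (w : List (Idx n)) (σ : Form n) :
    word (k :: w) σ = leftMul k (word w σ) := by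
  simp only [word, List.map_cons, List.prod_cons, Module.End.mul_apply]
  rfl

/-- The label of the number state to which the adjoint of a product of ladder operators sends
`|ν⟩`. -/
def steps {n : ℕ} : List (Idx n) → (Fin n → ℕ) → (Fin n → ℕ)
  | [], ν => ν
  | k :: w, ν => steps w (step k.swap ν)

/-- Each letter costs at most `√(total + 1)` and raises the total by at most one, so `d` letters
cost a power `d / 2` of the total. -/
theorem norm_word_le {n : ℕ} (w : List (Idx n)) (σ : Form n) (μ : Fin n → ℕ) (ψ : FiniteVec n) :
    ‖word w σ (numberState μ) ψ‖
      ≤ √(((total μ : ℝ) + w.length) ^ w.length) * ‖σ (numberState (steps w μ)) ψ‖ := by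
  induction w generalizing μ with
  | nil => simp [word_nil, steps]
  | cons k w ih =>
    rw [word_cons, leftMul_numberState, norm_mul, Complex.norm_real, Real.norm_eq_abs,
      abs_of_nonneg (amp_nonneg _ _), steps]
    have h : ((total (step k.swap μ) : ℕ) : ℝ) ≤ total μ + 1 := by
      exact_mod_cast total_step_le k.swap μ
    calc amp k.swap μ * ‖word w σ (numberState (step k.swap μ)) ψ‖
        ≤ √((total μ : ℝ) + 1 + w.length) *
          (√(((total μ : ℝ) + 1 + w.length) ^ w.length)
            * ‖σ (numberState (steps w (step k.swap μ))) ψ‖) := by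
          refine mul_le_mul ((amp_le _ _).trans (Real.sqrt_le_sqrt ?_)) ((ih _).trans ?_)
            (norm_nonneg _) (Real.sqrt_nonneg _)
          · simp
          · refine mul_le_mul_of_nonneg_right (Real.sqrt_le_sqrt ?_) (norm_nonneg _)
            gcongr
      _ = _ := by
          rw [← mul_assoc, ← Real.sqrt_mul (by positivity), ← pow_succ']
          simp [add_assoc, add_comm (1 : ℝ)]

/-- The populations `⟨ν|σ|ν⟩`. -/
def pop {n : ℕ} (σ : Form n) (ν : Fin n → ℕ) : ℝ := (σ (numberState ν) (numberState ν)).re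

theorem pop_nonneg {n : ℕ} {ρ : FockSpace n →L[ℂ] FockSpace n} (hρ : ρ.IsPositive)
    (ν : Fin n → ℕ) : 0 ≤ pop (toForm ρ) ν :=
  hρ.re_inner_nonneg_right _

theorem ofReal_pop {n : ℕ} {ρ : FockSpace n →L[ℂ] FockSpace n} (hρ : ρ.IsPositive)
    (ν : Fin n → ℕ) : (pop (toForm ρ) ν : ℂ) = toForm ρ (numberState ν) (numberState ν) := by
  have h := hρ.inner_nonneg_right (incl n (numberState ν))
  rw [← toForm_apply, Complex.nonneg_iff] at h
  exact Complex.ext (by simp [pop]) (by simpa using h.2)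

/-- Positivity on `x - c y`, with the phase `c` chosen to make the cross term real and non-negative.
The additive form, unlike Cauchy–Schwarz with a product, can be summed directly over number states.
-/
theorem norm_toForm_le {n : ℕ} {ρ : FockSpace n →L[ℂ] FockSpace n} (hρ : ρ.IsPositive)
    (φ ψ : FiniteVec n) :
    ‖toForm ρ φ ψ‖ ≤ ((toForm ρ φ φ).re + (toForm ρ ψ ψ).re) / 2 := by
  set x := incl n φ
  set y := incl n ψ
  obtain ⟨c, hc, hcz⟩ : ∃ c : ℂ, ‖c‖ = 1 ∧ c * toForm ρ φ ψ = ‖toForm ρ φ ψ‖ := by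
    by_cases h : toForm ρ φ ψ = 0
    · exact ⟨1, by simp, by simp [h]⟩
    · refine ⟨‖toForm ρ φ ψ‖ / toForm ρ φ ψ, ?_, ?_⟩
      · simp [h]
      · field_simp
  have hpos := hρ.re_inner_nonneg_right (x - c • y)
  have hsym : inner ℂ y (ρ x) = conj (inner ℂ x (ρ y)) := by
    rw [inner_conj_symm, hρ.inner_left_eq_inner_right]
  have hcc : conj c * c = 1 := by
    rw [← Complex.normSq_eq_conj_mul_self, Complex.normSq_eq_norm_sq, hc]; simp
  have hexp : inner ℂ (x - c • y) (ρ (x - c • y))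
      = toForm ρ φ φ + toForm ρ ψ ψ - (c * toForm ρ φ ψ + conj (c * toForm ρ φ ψ)) := by
    simp only [map_sub, map_smul, inner_sub_left, inner_sub_right, inner_smul_left,
      inner_smul_right, hsym, toForm_apply, map_mul]
    linear_combination inner ℂ y (ρ y) * hcc
  rw [hexp, hcz] at hpos
  simp at hpos
  linarith

/-- Weights which change by a factor of at most two from one integer to the next. -/
structure Doubling (u : ℕ → ℝ) : Prop where
  nonneg : ∀ z, 0 ≤ u z
  succ_le : ∀ z, u (z + 1) ≤ 2 * u z
  le_succ : ∀ z, u z ≤ 2 * u (z + 1)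

/-- The constant is `2 + 1`: doubling pays for the change of the total, and the labels with `ν i =
0`, which truncated subtraction leaves fixed, contribute at most one further copy of the sum. -/
theorem Doubling.step {n : ℕ} {u : ℕ → ℝ} (hu : Doubling u) {q : (Fin n → ℕ) → ℝ}
    (hq : ∀ ν, 0 ≤ q ν) (hs : Summable fun ν => u (total ν) * q ν) (k : Idx n) :
    (Summable fun ν => u (total ν) * q (step k ν)) ∧
      ∑' ν, u (total ν) * q (step k ν) ≤ 3 * ∑' ν, u (total ν) * q ν := by
  have h0 : ∀ ν, 0 ≤ u (total ν) * q ν := fun ν => mul_nonneg (hu.nonneg _) (hq _)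
  rcases k with i | i
  · set v : (Fin n → ℕ) → ℝ := fun ν => if ν i = 0 then 0 else
      u (total (BosonicGKSL.step (Sum.inl i) ν)) * q (BosonicGKSL.step (Sum.inl i) ν) with hv
    have hcomp : v ∘ (fun ν => ν + Pi.single i 1) = fun ν => u (total ν) * q ν := by
      funext ν
      simp [hv, BosonicGKSL.step]
    have hrange : ∀ ν ∉ Set.range (fun ν : Fin n → ℕ => ν + Pi.single i 1), v ν = 0 := by
      intro ν hν
      by_contra h
      refine hν ⟨_, sub_single_add_single (i := i) fun h' => h ?_⟩
      simp [hv, h']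
    have hsum : HasSum v (∑' ν, u (total ν) * q ν) := by
      rw [← (add_single_injective i).hasSum_iff hrange, hcomp]
      exact hs.hasSum
    have hle : ∀ ν, u (total ν) * q (BosonicGKSL.step (Sum.inl i) ν)
        ≤ 2 * v ν + u (total ν) * q ν := by
      intro ν
      by_cases h : ν i = 0
      · have : BosonicGKSL.step (Sum.inl i) ν = ν := by
          ext j
          by_cases hj : j = i
          · subst hj; simp [BosonicGKSL.step, h]
          · simp [BosonicGKSL.step, hj]
        simp [hv, h, this]
      · have h1 := total_add_single i (ν - Pi.single i 1)
        rw [sub_single_add_single h] at h1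
        have h2 := mul_le_mul_of_nonneg_right (hu.succ_le (total (ν - Pi.single i 1)))
          (hq (ν - Pi.single i 1))
        rw [← h1] at h2
        have h3 := h0 ν
        simp only [hv, h, if_false, BosonicGKSL.step, Sum.elim_inl]
        linarith
    have hsum' := (hsum.mul_left 2).add hs.hasSum
    have hsm := Summable.of_nonneg_of_le (fun ν => mul_nonneg (hu.nonneg _) (hq _)) hle
      hsum'.summable
    refine ⟨hsm, (hsm.tsum_le_tsum hle hsum'.summable).trans ?_⟩
    rw [hsum'.tsum_eq]
    linarith
  · have hle : ∀ ν, u (total ν) * q (BosonicGKSL.step (Sum.inr i) ν)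
        ≤ 2 * (u (total (ν + Pi.single i 1)) * q (ν + Pi.single i 1)) := by
      intro ν
      rw [total_add_single, ← mul_assoc]
      exact mul_le_mul_of_nonneg_right (hu.le_succ _) (hq _)
    have hsc := hs.comp_injective (add_single_injective i)
    have hsm := Summable.of_nonneg_of_le (fun ν => mul_nonneg (hu.nonneg _) (hq _)) hle
      (hsc.mul_left 2)
    refine ⟨hsm, (hsm.tsum_le_tsum hle (hsc.mul_left 2)).trans ?_⟩
    rw [tsum_mul_left]
    have h1 := tsum_comp_le_tsum_of_inj hs h0 (add_single_injective i)
    have h2 : 0 ≤ ∑' ν, u (total ν) * q ν := tsum_nonneg h0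
    simp only [Function.comp_def] at h1
    linarith

theorem Doubling.steps {n : ℕ} {u : ℕ → ℝ} (hu : Doubling u) {q : (Fin n → ℕ) → ℝ}
    (hq : ∀ ν, 0 ≤ q ν) (hs : Summable fun ν => u (total ν) * q ν) (w : List (Idx n)) :
    (Summable fun ν => u (total ν) * q (steps w ν)) ∧
      ∑' ν, u (total ν) * q (steps w ν) ≤ 3 ^ w.length * ∑' ν, u (total ν) * q ν := by
  induction w with
  | nil => simpa [BosonicGKSL.steps] using hs
  | cons k w ih =>
    have h := hu.step (fun ν => hq (BosonicGKSL.steps w ν)) ih.1 k.swap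
    refine ⟨h.1, h.2.trans ?_⟩
    rw [List.length_cons, pow_succ', mul_assoc]
    exact mul_le_mul_of_nonneg_left ih.2 (by norm_num)

/-- The function which dominates the diagonal of a product of ladder operators times a density
matrix. -/
def dominant {n : ℕ} (u : ℕ → ℝ) (w : List (Idx n)) (σ : Form n) (ν : Fin n → ℕ) : ℝ :=
  (u (total ν) * pop σ (steps w ν) + u (total ν) * pop σ ν) / 2

theorem Doubling.dominant {n : ℕ} {u : ℕ → ℝ} (hu : Doubling u)
    {ρ : FockSpace n →L[ℂ] FockSpace n} (hρ : ρ.IsPositive)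
    (hs : Summable fun ν => u (total ν) * pop (toForm ρ) ν) (w : List (Idx n)) :
    Summable (dominant u w (toForm ρ)) ∧
      ∑' ν, dominant u w (toForm ρ) ν
        ≤ 3 ^ w.length * ∑' ν, u (total ν) * pop (toForm ρ) ν := by
  obtain ⟨h1, h2⟩ := hu.steps (pop_nonneg hρ) hs w
  have h3 := (h1.hasSum.add hs.hasSum).div_const 2
  refine ⟨h3.summable, ?_⟩
  rw [show ∑' ν, BosonicGKSL.dominant u w (toForm ρ) ν = _ from h3.tsum_eq]
  have h4 : 0 ≤ ∑' ν, u (total ν) * pop (toForm ρ) ν :=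
    tsum_nonneg fun ν => mul_nonneg (hu.nonneg _) (pop_nonneg hρ _)
  have h5 : (1 : ℝ) ≤ 3 ^ w.length := one_le_pow₀ (by norm_num)
  nlinarith

theorem norm_diag_le {n : ℕ} {u : ℕ → ℝ} {ρ : FockSpace n →L[ℂ] FockSpace n}
    (hρ : ρ.IsPositive) (w : List (Idx n)) {h : ℕ → ℂ} {C : ℝ}
    (hh : ∀ z, ‖h z‖ * √(((z : ℝ) + w.length) ^ w.length) ≤ C * u z) (ν : Fin n → ℕ) :
    ‖h (total ν) * word w (toForm ρ) (numberState ν) (numberState ν)‖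
      ≤ C * dominant u w (toForm ρ) ν := by
  rw [norm_mul]
  have h1 := norm_word_le w (toForm ρ) ν (numberState ν)
  have h2 := norm_toForm_le hρ (numberState (steps w ν)) (numberState ν)
  have h3 : 0 ≤ pop (toForm ρ) (steps w ν) := pop_nonneg hρ _
  have h4 : 0 ≤ pop (toForm ρ) ν := pop_nonneg hρ _
  calc _ ≤ ‖h (total ν)‖ * (√(((total ν : ℝ) + w.length) ^ w.length)
          * ((pop (toForm ρ) (steps w ν) + pop (toForm ρ) ν) / 2)) := by
        refine mul_le_mul_of_nonneg_left (h1.trans ?_) (norm_nonneg _)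
        exact mul_le_mul_of_nonneg_left h2 (Real.sqrt_nonneg _)
    _ ≤ C * u (total ν) * ((pop (toForm ρ) (steps w ν) + pop (toForm ρ) ν) / 2) := by
        rw [← mul_assoc]
        exact mul_le_mul_of_nonneg_right (hh _) (by linarith)
    _ = _ := by rw [dominant]; ring

theorem norm_cutTrace_word_le {n : ℕ} {u : ℕ → ℝ} (hu : Doubling u)
    {ρ : FockSpace n →L[ℂ] FockSpace n} (hρ : ρ.IsPositive)
    (hs : Summable fun ν => u (total ν) * pop (toForm ρ) ν) (w : List (Idx n)) (χ : Cutoff)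
    {C : ℝ} (hC : 0 ≤ C)
    (hh : ∀ z, ‖(χ : ℕ → ℂ) z‖ * √(((z : ℝ) + w.length) ^ w.length) ≤ C * u z) :
    ‖cutTrace n χ (word w (toForm ρ))‖
      ≤ C * (3 ^ w.length * ∑' ν, u (total ν) * pop (toForm ρ) ν) := by
  obtain ⟨h1, h2⟩ := hu.dominant hρ hs w
  have h3 := (h1.mul_left C).of_nonneg_of_le (fun ν => norm_nonneg _) (norm_diag_le hρ w hh)
  refine (norm_tsum_le_tsum_norm h3).trans ((h3.tsum_le_tsum (norm_diag_le hρ w hh)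
    (h1.mul_left C)).trans ?_)
  rw [tsum_mul_left]
  exact mul_le_mul_of_nonneg_left h2 hC

open Filter Topology in
theorem tendsto_cutTrace_word {n : ℕ} {u : ℕ → ℝ} (hu : Doubling u)
    {ρ : FockSpace n →L[ℂ] FockSpace n} (hρ : ρ.IsPositive)
    (hs : Summable fun ν => u (total ν) * pop (toForm ρ) ν) (w : List (Idx n)) (χ : ℕ → Cutoff)
    {h : ℕ → ℂ} (hlim : ∀ z, Tendsto (fun R => (χ R : ℕ → ℂ) z) atTop (𝓝 (h z))) {C : ℝ}
    (hh : ∀ R z, ‖(χ R : ℕ → ℂ) z‖ * √(((z : ℝ) + w.length) ^ w.length) ≤ C * u z) :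
    Tendsto (fun R => cutTrace n (χ R) (word w (toForm ρ))) atTop
      (𝓝 (∑' ν, h (total ν) * word w (toForm ρ) (numberState ν) (numberState ν))) := by
  refine tendsto_tsum_of_dominated_convergence ((hu.dominant hρ hs w).1.mul_left C)
    (fun ν => (hlim _).mul_const _) (Eventually.of_forall fun R ν => norm_diag_le hρ w (hh R) ν)

theorem word_rightMul {n : ℕ} (w : List (Idx n)) (k : Idx n) (σ : Form n) :
    word w (rightMul k σ) = rightMul k (word w σ) := by
  induction w with
  | nil => rfl
  | cons l w ih => rw [word_cons, word_cons, ih, leftMul_rightMul]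

theorem exists_word_eq_comp {n : ℕ} (w : List (Idx n)) :
    ∃ A : FiniteVec n →ₗ[ℂ] FiniteVec n, ∀ (σ : Form n) φ ψ, word w σ φ ψ = σ (A φ) ψ := by
  induction w with
  | nil => exact ⟨LinearMap.id, fun _ _ _ => rfl⟩
  | cons l w ih =>
    obtain ⟨A, hA⟩ := ih
    refine ⟨A ∘ₗ ladder l.swap, fun σ φ ψ => ?_⟩
    rw [word_cons, leftMul, LinearMap.comp_apply, hA, LinearMap.comp_apply]

/-- The finite set and the operator do not depend on `σ`, so the weak equation can be applied term
by term along a solution. -/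
theorem exists_cutTrace_eq_sum {n : ℕ} (χ : Cutoff) (w : List (Idx n)) :
    ∃ (s : Finset (Fin n → ℕ)) (A : FiniteVec n →ₗ[ℂ] FiniteVec n), ∀ σ : Form n,
      cutTrace n χ (word w σ)
        = ∑ ν ∈ s, (χ : ℕ → ℂ) (total ν) * σ (A (numberState ν)) (numberState ν) := by
  obtain ⟨A, hA⟩ := exists_word_eq_comp w
  obtain ⟨χ, R, hR⟩ := χ
  refine ⟨(finite_total_lt n R).toFinset, A, fun σ => ?_⟩
  rw [cutTrace_apply, tsum_eq_sum (s := (finite_total_lt n R).toFinset)]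
  · simp only [hA]
  · intro ν hν
    simp only [Set.Finite.mem_toFinset, Set.mem_ofPred_eq, not_lt] at hν
    simp [hR _ hν]

theorem IsSolution.hasDerivWithinAt_cutTrace {n : ℕ}
    {H Γ : ℝ → Matrix (Idx n) (Idx n) ℂ} {f : ℝ → Idx n → ℂ}
    {ρ : ℝ → FockSpace n →L[ℂ] FockSpace n} (hsol : IsSolution H Γ f ρ) (χ : Cutoff)
    (w : List (Idx n)) {t : ℝ} (ht : 0 ≤ t) :
    HasDerivWithinAt (fun s => cutTrace n χ (word w (toForm (ρ s))))
      (cutTrace n χ (word w (generator (H t) (Γ t) (f t) (toForm (ρ t))))) (Set.Ici 0) t := by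
  obtain ⟨s, A, h⟩ := exists_cutTrace_eq_sum χ w
  simp only [h]
  exact HasDerivWithinAt.fun_sum fun ν _ => (hsol t ht _ _).const_mul _

theorem IsSolution.continuousOn_cutTrace {n : ℕ}
    {H Γ : ℝ → Matrix (Idx n) (Idx n) ℂ} {f : ℝ → Idx n → ℂ}
    {ρ : ℝ → FockSpace n →L[ℂ] FockSpace n} (hsol : IsSolution H Γ f ρ) (χ : Cutoff)
    (w : List (Idx n)) :
    ContinuousOn (fun s => cutTrace n χ (word w (toForm (ρ s)))) (Set.Ici 0) :=
  fun _ ht => (hsol.hasDerivWithinAt_cutTrace χ w ht).continuousWithinAt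

/-! ### The generator under a cut-off trace. -/

section Generator

variable {n : ℕ} (χ : Cutoff) (w : List (Idx n)) (σ : Form n)

theorem cutTrace_word_leftQuad (K : Matrix (Idx n) (Idx n) ℂ) :
    cutTrace n χ (word w (leftQuad K σ))
      = ∑ k, ∑ l, K k l * cutTrace n χ (word (w ++ [k, l]) σ) := by
  simp only [leftQuad, map_sum, map_smul, smul_eq_mul, word, List.map_append, List.prod_append]
  rfl

theorem cutTrace_word_leftLin (g : Idx n → ℂ) :
    cutTrace n χ (word w (leftLin g σ)) = ∑ k, g k * cutTrace n χ (word (w ++ [k]) σ) := by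
  simp only [leftLin, map_sum, map_smul, smul_eq_mul, word, List.map_append, List.prod_append]
  rfl

theorem cutTrace_word_rightQuad (K : Matrix (Idx n) (Idx n) ℂ) :
    cutTrace n χ (word w (rightQuad K σ))
      = ∑ k, ∑ l, K k l * cutTrace n (shift k (shift l χ)) (word ([k, l] ++ w) σ) := by
  simp only [rightQuad, map_sum, map_smul, smul_eq_mul, word_rightMul, cutTrace_rightMul,
    leftMul_rightMul, List.cons_append, List.nil_append, word_cons]

theorem cutTrace_word_rightLin (g : Idx n → ℂ) :
    cutTrace n χ (word w (rightLin g σ))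
      = ∑ k, g k * cutTrace n (shift k χ) (word ([k] ++ w) σ) := by
  simp only [rightLin, map_sum, map_smul, smul_eq_mul, word_rightMul, cutTrace_rightMul,
    List.cons_append, List.nil_append, word_cons]

theorem cutTrace_word_sandwich (K : Matrix (Idx n) (Idx n) ℂ) :
    cutTrace n χ (word w (sandwich K σ))
      = ∑ k, ∑ l, K k l * cutTrace n (shift l χ) (word ([l] ++ w ++ [k]) σ) := by
  have h : ∀ k, word w (leftMul k σ) = word (w ++ [k]) σ := fun k => by
    simp only [word, List.map_append, List.prod_append]
    rfl
  simp only [sandwich, map_sum, map_smul, smul_eq_mul, leftMul_rightMul, word_rightMul,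
    cutTrace_rightMul, List.cons_append, List.nil_append, word_cons, h]

/-- The contribution of `H k l` to the time derivative of a cut off moment. -/
def hamTerm (k l : Idx n) : ℂ :=
  cutTrace n χ (word (w ++ [k, l]) σ) - cutTrace n (shift k (shift l χ)) (word ([k, l] ++ w) σ)

/-- The contribution of `f k` to the time derivative of a cut off moment. -/
def driveTerm (k : Idx n) : ℂ :=
  cutTrace n χ (word (w ++ [k]) σ) - cutTrace n (shift k χ) (word ([k] ++ w) σ)

/-- The contribution of `Γ k l` to the time derivative of a cut off moment. -/
def dissTerm (k l : Idx n) : ℂ :=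
  cutTrace n (shift l χ) (word ([l] ++ w ++ [k]) σ)
    - 1 / 2 * cutTrace n χ (word (w ++ [l, k]) σ)
    - 1 / 2 * cutTrace n (shift l (shift k χ)) (word ([l, k] ++ w) σ)

theorem cutTrace_word_generator (H Γ : Matrix (Idx n) (Idx n) ℂ) (f : Idx n → ℂ) :
    cutTrace n χ (word w (generator H Γ f σ))
      = ∑ k, ∑ l, (-Complex.I / 2 * H k l) * hamTerm χ w σ k l
        + ∑ k, (-Complex.I * f k) * driveTerm χ w σ k
        + ∑ k, ∑ l, Γ k l * dissTerm χ w σ k l := by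
  have h1 := cutTrace_word_leftQuad χ w σ Γ.transpose
  have h2 := cutTrace_word_rightQuad χ w σ Γ.transpose
  -- The two terms with the transpose of `Γ` are relabelled so that all dissipative contributions
  -- share the coefficient `Γ k l`.
  rw [Finset.sum_comm] at h1 h2
  simp only [Matrix.transpose_apply] at h1 h2
  simp only [generator, map_add, map_sub, map_smul, h1, h2, cutTrace_word_leftQuad,
    cutTrace_word_rightQuad, cutTrace_word_leftLin, cutTrace_word_rightLin,
    cutTrace_word_sandwich, hamTerm, driveTerm, dissTerm, smul_eq_mul, mul_sub, mul_assoc,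
    Finset.sum_sub_distrib, ← Finset.mul_sum, mul_left_comm _ (1 / 2 : ℂ)]
  ring

end Generator

/-! ### The logarithmic weight and slowly varying cut-offs. -/

/-- A weight that is `z + 2` up to some point, beyond which it decays logarithmically to `1`. -/
def logWeight (c : ℝ) (z : ℕ) : ℝ := min ((z : ℝ) + 2) (max 1 (c - Real.log (z + 1)))

theorem one_le_logWeight (c : ℝ) (z : ℕ) : 1 ≤ logWeight c z :=
  le_min (by linarith [(z.cast_nonneg : (0 : ℝ) ≤ z)]) (le_max_left _ _)

theorem logWeight_le (c : ℝ) (z : ℕ) : logWeight c z ≤ z + 2 := min_le_left _ _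

/-- The weight divided by `z + 1` does not increase; by `mul_logWeight_le`, the weight times `z + 1`
does not decrease. Together they bound its relative variation by `O(1 / z)` uniformly in `c`, which
gives both the doubling property and the slow variation. -/
theorem logWeight_mul_le (c : ℝ) {z x : ℕ} (h : z ≤ x) :
    ((z : ℝ) + 1) * logWeight c x ≤ (x + 1) * logWeight c z := by
  have hz : (0 : ℝ) ≤ z := z.cast_nonneg
  have hzx : (z : ℝ) ≤ x := by exact_mod_cast h
  rw [logWeight.eq_1 c z, mul_min_of_nonneg _ _ (by linarith)]
  refine le_min ?_ ?_
  · calc ((z : ℝ) + 1) * logWeight c x ≤ (z + 1) * (x + 2) := by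
          gcongr
          exact logWeight_le c x
      _ ≤ _ := by nlinarith
  · calc ((z : ℝ) + 1) * logWeight c x ≤ (z + 1) * max 1 (c - Real.log (x + 1)) := by
          gcongr
          exact min_le_right _ _
      _ ≤ _ := by gcongr

theorem mul_logWeight_le (c : ℝ) {z x : ℕ} (h : z ≤ x) :
    ((z : ℝ) + 1) * logWeight c z ≤ (x + 1) * logWeight c x := by
  have hz : (0 : ℝ) ≤ z := z.cast_nonneg
  have hzx : (z : ℝ) ≤ x := by exact_mod_cast h
  rw [logWeight.eq_1 c x, mul_min_of_nonneg _ _ (by linarith)]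
  refine le_min ?_ ?_
  · calc ((z : ℝ) + 1) * logWeight c z ≤ (z + 1) * (z + 2) := by
          gcongr
          exact logWeight_le c z
      _ ≤ _ := by nlinarith
  · have h1 : (1 : ℝ) ≤ max 1 (c - Real.log (x + 1)) := le_max_left _ _
    calc ((z : ℝ) + 1) * logWeight c z ≤ (z + 1) * max 1 (c - Real.log (z + 1)) := by
          gcongr
          exact min_le_right _ _
      _ ≤ _ := by
          rw [mul_max_of_nonneg _ _ (by linarith)]
          refine max_le ?_ ?_
          · nlinarith
          · have h2 : c - Real.log (x + 1) ≤ max 1 (c - Real.log (x + 1)) := le_max_right _ _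
            -- Multiplied by `z + 1`, the drop of the logarithmic branch is at most `x - z`. The
            -- growth of the prefactor compensates it because the weight is at least one.
            have h3 : Real.log (((x : ℝ) + 1) / (z + 1)) ≤ ((x : ℝ) + 1) / (z + 1) - 1 :=
              Real.log_le_sub_one_of_pos (by positivity)
            rw [Real.log_div (by positivity) (by positivity)] at h3
            have h4 : ((z : ℝ) + 1) * (Real.log (x + 1) - Real.log (z + 1)) ≤ x - z := by
              calc _ ≤ ((z : ℝ) + 1) * (((x : ℝ) + 1) / (z + 1) - 1) := by gcongr
                _ = _ := by field_simp; ring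
            nlinarith

theorem doubling_logWeight (c : ℝ) : Doubling (logWeight c) where
  nonneg z := zero_le_one.trans (one_le_logWeight c z)
  succ_le z := by
    have h := logWeight_mul_le c (Nat.le_succ z)
    have h0 := one_le_logWeight c z
    have hz : (0 : ℝ) ≤ z := z.cast_nonneg
    push_cast at h
    by_contra! h'
    nlinarith
  le_succ z := by
    have h := mul_logWeight_le c (Nat.le_succ z)
    have h0 := one_le_logWeight c (z + 1)
    have hz : (0 : ℝ) ≤ z := z.cast_nonneg
    push_cast at h
    by_contra! h'
    nlinarith

/-- The two monotonicities bound the left side by `|x - z| ≤ 2` times one of the two weights, and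
the weight at `x` is at most three times the weight at `z`; hence `6`. A distance of two suffices
because at most two ladder operators are moved around the trace. -/
theorem abs_logWeight_sub_le (c : ℝ) {x z : ℕ} (h1 : x ≤ z + 2) (h2 : z ≤ x + 2) :
    |logWeight c x - logWeight c z| * (z + 1) ≤ 6 * logWeight c z := by
  have hx0 := one_le_logWeight c x
  have hz0 := one_le_logWeight c z
  have hz : (0 : ℝ) ≤ z := z.cast_nonneg
  have hx : (0 : ℝ) ≤ x := x.cast_nonneg
  have h1' : (x : ℝ) ≤ z + 2 := by exact_mod_cast h1
  have h2' : (z : ℝ) ≤ x + 2 := by exact_mod_cast h2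
  rcases le_total z x with h | h
  · have h3 := logWeight_mul_le c h
    have h4 := mul_logWeight_le c h
    have h' : (z : ℝ) ≤ x := by exact_mod_cast h
    have h5 : logWeight c x ≤ 3 * logWeight c z := by
      by_contra! h'
      nlinarith
    rcases abs_cases (logWeight c x - logWeight c z) with h6 | h6 <;> rw [h6.1] <;> nlinarith
  · have h3 := logWeight_mul_le c h
    have h4 := mul_logWeight_le c h
    have h' : (x : ℝ) ≤ z := by exact_mod_cast h
    rcases abs_cases (logWeight c x - logWeight c z) with h6 | h6 <;> rw [h6.1] <;> nlinarith

theorem sqrt_pow_le_linear {d : ℕ} (hd : d ≤ 2) (z : ℕ) :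
    √(((z : ℝ) + d) ^ d) ≤ 2 * (z + 1) := by
  have hz : (0 : ℝ) ≤ z := z.cast_nonneg
  refine Real.sqrt_le_iff.2 ⟨by positivity, ?_⟩
  interval_cases d <;> push_cast <;> nlinarith

theorem sqrt_pow_le_quadratic {d : ℕ} (hd : d ≤ 4) (z : ℕ) :
    √(((z : ℝ) + d) ^ d) ≤ 16 * (z + 1) ^ 2 := by
  have hz : (0 : ℝ) ≤ z := z.cast_nonneg
  have h1 : (z : ℝ) + d ≤ 4 * (z + 1) := by
    have : (d : ℝ) ≤ 4 := by exact_mod_cast hd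
    linarith
  have h2 : ((z : ℝ) + d) ^ d ≤ (4 * (z + 1)) ^ 4 :=
    (pow_le_pow_left₀ (by positivity) h1 d).trans (pow_le_pow_right₀ (by linarith) hd)
  refine (Real.sqrt_le_sqrt h2).trans (le_of_eq ?_)
  rw [show (4 * ((z : ℝ) + 1)) ^ 4 = (16 * (z + 1) ^ 2) ^ 2 by ring]
  exact Real.sqrt_sq (by positivity)

/-- A function of the total number which varies slowly in comparison with the weight `u`. -/
def Slow (χ : Cutoff) (C : ℝ) (u : ℕ → ℝ) : Prop :=
  ∀ x z : ℕ, x ≤ z + 2 → z ≤ x + 2 →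
    ‖(χ : ℕ → ℂ) x - (χ : ℕ → ℂ) z‖ * ((z : ℝ) + 1) ≤ C * u z

theorem shiftNat_le {n : ℕ} (k : Idx n) (z : ℕ) : shiftNat k z ≤ z + 1 ∧ z ≤ shiftNat k z + 1 := by
  rcases k with i | i <;> simp only [shiftNat, Sum.elim_inl, Sum.elim_inr] <;> omega

theorem Slow.sub_shift {n : ℕ} {χ : Cutoff} {C : ℝ} {u : ℕ → ℝ} (h : Slow χ C u) (k : Idx n)
    (z : ℕ) : ‖((χ - shift k χ : Cutoff) : ℕ → ℂ) z‖ * ((z : ℝ) + 1) ≤ C * u z := by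
  have hk := shiftNat_le k z
  have := h (shiftNat k z) z (by omega) (by omega)
  rw [norm_sub_rev] at this
  exact this

theorem Slow.sub_shift_shift {n : ℕ} {χ : Cutoff} {C : ℝ} {u : ℕ → ℝ} (h : Slow χ C u)
    (k l : Idx n) (z : ℕ) :
    ‖((χ - shift k (shift l χ) : Cutoff) : ℕ → ℂ) z‖ * ((z : ℝ) + 1) ≤ C * u z := by
  have hk := shiftNat_le k z
  have hl := shiftNat_le l (shiftNat k z)
  have := h (shiftNat l (shiftNat k z)) z (by omega) (by omega)
  rw [norm_sub_rev] at this
  exact this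

theorem mul_sqrt_le_of_length_le_two {a b : ℝ} (ha : 0 ≤ a) {d : ℕ} (hd : d ≤ 2) {z : ℕ}
    (h : a * ((z : ℝ) + 1) ≤ b) : a * √(((z : ℝ) + d) ^ d) ≤ 2 * b := by
  have := mul_le_mul_of_nonneg_left (sqrt_pow_le_linear hd z) ha
  linarith

theorem mul_sqrt_le_of_length_le_four {a b : ℝ} (ha : 0 ≤ a) {d : ℕ} (hd : d ≤ 4) {z : ℕ}
    (h : a * ((z : ℝ) + 1) ≤ b) : a * √(((z : ℝ) + d) ^ d) ≤ 16 * b * (z + 1) := by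
  have h1 := mul_le_mul_of_nonneg_left (sqrt_pow_le_quadratic hd z) ha
  have h2 := mul_le_mul_of_nonneg_right h (by positivity : (0 : ℝ) ≤ z + 1)
  linarith

/-- The sum of the moduli of the coefficients of a generator. -/
def coeffSize {n : ℕ} (H Γ : Matrix (Idx n) (Idx n) ℂ) (f : Idx n → ℂ) : ℝ :=
  ∑ k, ∑ l, ‖H k l‖ + ∑ k, ‖f k‖ + ∑ k, ∑ l, ‖Γ k l‖

/-- For the empty word both sides carry the same product of ladder operators, so no commutator
appears and only differences of cut-offs remain. -/
theorem hamTerm_nil {n : ℕ} (χ : Cutoff) (σ : Form n) (k l : Idx n) :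
    hamTerm χ [] σ k l = cutTrace n (χ - shift k (shift l χ)) (word [k, l] σ) := by
  simp [hamTerm]

theorem driveTerm_nil {n : ℕ} (χ : Cutoff) (σ : Form n) (k : Idx n) :
    driveTerm χ [] σ k = cutTrace n (χ - shift k χ) (word [k] σ) := by
  simp [driveTerm]

theorem dissTerm_nil {n : ℕ} (χ : Cutoff) (σ : Form n) (k l : Idx n) :
    dissTerm χ [] σ k l = 1 / 2 * cutTrace n (χ - shift l (shift k χ)) (word [l, k] σ)
      - cutTrace n (χ - shift l χ) (word [l, k] σ) := by
  simp only [dissTerm, List.nil_append, List.append_nil, List.cons_append, map_sub,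
    LinearMap.sub_apply]
  ring

/-- The time derivative of a slowly varying function of the total number is controlled by the
weight. -/
theorem norm_cutTrace_generator_le {n : ℕ} {u : ℕ → ℝ} (hu : Doubling u)
    {ρ : FockSpace n →L[ℂ] FockSpace n} (hρ : ρ.IsPositive)
    (hs : Summable fun ν => u (total ν) * pop (toForm ρ) ν) {χ : Cutoff} {C : ℝ} (hC : 0 ≤ C)
    (hχ : Slow χ C u) (H Γ : Matrix (Idx n) (Idx n) ℂ) (f : Idx n → ℂ) :
    ‖cutTrace n χ (word [] (generator H Γ f (toForm ρ)))‖
      ≤ 27 * C * (∑' ν, u (total ν) * pop (toForm ρ) ν) * coeffSize H Γ f := by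
  set S := ∑' ν, u (total ν) * pop (toForm ρ) ν with hS
  have hS0 : 0 ≤ S := tsum_nonneg fun ν => mul_nonneg (hu.nonneg _) (pop_nonneg hρ _)
  -- `18 = 2 * 3 ^ 2`, from `sqrt_pow_le_linear` and the factor three for each of two letters. The
  -- dissipative term has coefficients `1 / 2` and `1`, whence `27`.
  have key : ∀ (w : List (Idx n)) (η : Cutoff), w.length ≤ 2 →
      (∀ z : ℕ, ‖(η : ℕ → ℂ) z‖ * ((z : ℝ) + 1) ≤ C * u z) →
      ‖cutTrace n η (word w (toForm ρ))‖ ≤ 18 * C * S := by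
    intro w η hw hη
    refine (norm_cutTrace_word_le hu hρ hs w η (C := 2 * C) (by linarith) fun z => ?_).trans ?_
    · rw [mul_assoc]
      exact mul_sqrt_le_of_length_le_two (norm_nonneg _) hw (hη z)
    · have : (3 : ℝ) ^ w.length ≤ 3 ^ 2 := pow_le_pow_right₀ (by norm_num) hw
      calc 2 * C * (3 ^ w.length * S) ≤ 2 * C * (3 ^ 2 * S) := by gcongr
        _ = _ := by ring
  have hham : ∀ k l, ‖hamTerm χ [] (toForm ρ) k l‖ ≤ 18 * C * S := fun k l => by
    rw [hamTerm_nil]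
    exact key _ _ (by simp) (hχ.sub_shift_shift k l)
  have hdrive : ∀ k, ‖driveTerm χ [] (toForm ρ) k‖ ≤ 18 * C * S := fun k => by
    rw [driveTerm_nil]
    exact key _ _ (by simp) (hχ.sub_shift k)
  have hdiss : ∀ k l, ‖dissTerm χ [] (toForm ρ) k l‖ ≤ 27 * C * S := fun k l => by
    rw [dissTerm_nil]
    refine (norm_sub_le _ _).trans ?_
    rw [norm_mul]
    have h1 := key [l, k] _ (by simp) (hχ.sub_shift_shift l k)
    have h2 := key [l, k] _ (by simp) (hχ.sub_shift l)
    norm_num at h1 h2 ⊢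
    linarith
  have hCS : 0 ≤ C * S := mul_nonneg hC hS0
  rw [cutTrace_word_generator, coeffSize, mul_add, mul_add]
  refine (norm_add₃_le).trans (add_le_add (add_le_add ?_ ?_) ?_)
  · simp only [Finset.mul_sum]
    refine norm_sum_le_of_le _ fun k _ => norm_sum_le_of_le _ fun l _ => ?_
    rw [norm_mul, norm_mul, norm_div, norm_neg, Complex.norm_I, Complex.norm_ofNat]
    have := mul_le_mul_of_nonneg_left (hham k l) (norm_nonneg (H k l))
    nlinarith [mul_nonneg (norm_nonneg (H k l)) hCS]
  · simp only [Finset.mul_sum]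
    refine norm_sum_le_of_le _ fun k _ => ?_
    rw [norm_mul, norm_mul, norm_neg, Complex.norm_I]
    have := mul_le_mul_of_nonneg_left (hdrive k) (norm_nonneg (f k))
    nlinarith [mul_nonneg (norm_nonneg (f k)) hCS]
  · simp only [Finset.mul_sum]
    refine norm_sum_le_of_le _ fun k _ => norm_sum_le_of_le _ fun l _ => ?_
    rw [norm_mul]
    have := mul_le_mul_of_nonneg_left (hdiss k l) (norm_nonneg (Γ k l))
    linarith

/-- The cut-off `logWeight c - 1`. -/
def logCutoff (c : ℝ) : Cutoff :=
  ⟨fun z => ((logWeight c z - 1 : ℝ) : ℂ), ⌈Real.exp (c - 1)⌉₊, fun z hz => by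
    have h1 : Real.exp (c - 1) ≤ z := (Nat.le_ceil _).trans (by exact_mod_cast hz)
    have h2 : c - 1 ≤ Real.log (z + 1) :=
      (Real.le_log_iff_exp_le (by positivity)).2 (by linarith)
    have h3 : (1 : ℝ) ≤ z + 2 := by linarith [(z.cast_nonneg : (0 : ℝ) ≤ z)]
    have h4 : logWeight c z = 1 := by
      rw [logWeight, max_eq_left (by linarith), min_eq_right h3]
    simp [h4]⟩

theorem slow_logCutoff (c : ℝ) : Slow (logCutoff c) 6 (logWeight c) := by
  intro x z h1 h2
  have h := abs_logWeight_sub_le c h1 h2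
  simp only [logCutoff]
  rw [← Complex.ofReal_sub, Complex.norm_real, Real.norm_eq_abs, sub_sub_sub_cancel_right]
  exact h

/-! ### Local boundedness of the energy. -/

/-- The mean of the total number plus one. -/
def energy {n : ℕ} (σ : Form n) : ℝ := ∑' ν : Fin n → ℕ, ((total ν : ℝ) + 1) * pop σ ν

section Density

variable {n : ℕ} {ρ : FockSpace n →L[ℂ] FockSpace n}

theorem IsDensity.hasSum_pop (hρ : IsDensity ρ) : HasSum (pop (toForm ρ)) 1 := by
  have h := Complex.hasSum_re hρ.trace_one
  rwa [Complex.one_re] at h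

theorem IsDensity.summable_logWeight (hρ : IsDensity ρ)
    (hs : Summable fun ν : Fin n → ℕ => ((total ν : ℝ) + 1) * pop (toForm ρ) ν) (c : ℝ) :
    Summable fun ν => logWeight c (total ν) * pop (toForm ρ) ν := by
  refine Summable.of_nonneg_of_le (fun ν => mul_nonneg ((doubling_logWeight c).nonneg _)
    (pop_nonneg hρ.pos _)) (fun ν => ?_) (hs.mul_left 2)
  rw [← mul_assoc]
  refine mul_le_mul_of_nonneg_right ((logWeight_le _ _).trans ?_) (pop_nonneg hρ.pos _)
  linarith [((total ν).cast_nonneg : (0 : ℝ) ≤ total ν)]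

theorem IsDensity.cutTrace_logCutoff (hρ : IsDensity ρ) (c : ℝ) :
    cutTrace n (logCutoff c) (word [] (toForm ρ))
      = ((∑' ν, (logWeight c (total ν) - 1) * pop (toForm ρ) ν : ℝ) : ℂ) := by
  rw [cutTrace_apply, Complex.ofReal_tsum]
  refine tsum_congr fun ν => ?_
  rw [word_nil, Complex.ofReal_mul, ofReal_pop hρ.pos]
  rfl

/-- Trace one makes the weighted sum that controls the derivative equal to the cut-off trace plus
one, so the differential inequality closes. -/
theorem IsDensity.norm_cutTrace_logCutoff (hρ : IsDensity ρ)
    (hs : Summable fun ν : Fin n → ℕ => ((total ν : ℝ) + 1) * pop (toForm ρ) ν) (c : ℝ) :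
    ‖cutTrace n (logCutoff c) (word [] (toForm ρ))‖
      = ∑' ν, logWeight c (total ν) * pop (toForm ρ) ν - 1 := by
  rw [hρ.cutTrace_logCutoff, Complex.norm_real, Real.norm_eq_abs, abs_of_nonneg]
  · simp only [sub_mul, one_mul]
    rw [(hρ.summable_logWeight hs c).tsum_sub hρ.hasSum_pop.summable, hρ.hasSum_pop.tsum_eq]
  · exact tsum_nonneg fun ν => mul_nonneg (sub_nonneg.2 (one_le_logWeight _ _))
      (pop_nonneg hρ.pos _)

open Filter in
/-- A bound on all the cut-offs is a bound on the energy. -/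
theorem IsDensity.energy_le (hρ : IsDensity ρ)
    (hs : Summable fun ν : Fin n → ℕ => ((total ν : ℝ) + 1) * pop (toForm ρ) ν) {B : ℝ}
    (hB : ∀ c, ‖cutTrace n (logCutoff c) (word [] (toForm ρ))‖ ≤ B) : energy (toForm ρ) ≤ B := by
  refine hs.tsum_le_of_sum_le fun s => ?_
  -- On a finite set of labels the cut-off `logWeight c - 1` is exactly `total + 1` once `c` is
  -- large.
  have h1 : ∀ᶠ c : ℝ in atTop, ∀ ν ∈ s, logWeight c (total ν) = total ν + 2 := by
    rw [Filter.eventually_all_finset]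
    intro ν _
    filter_upwards [eventually_ge_atTop ((total ν : ℝ) + 2 + Real.log (total ν + 1))] with c hc
    exact min_eq_left (le_max_of_le_right (by linarith))
  obtain ⟨c, hc⟩ := h1.exists
  refine le_trans ?_ (hB c)
  have h2 := (hρ.summable_logWeight hs c).tsum_sub hρ.hasSum_pop.summable
  rw [hρ.hasSum_pop.tsum_eq] at h2
  rw [hρ.norm_cutTrace_logCutoff hs, ← h2]
  calc ∑ ν ∈ s, ((total ν : ℝ) + 1) * pop (toForm ρ) ν
      = ∑ ν ∈ s, (logWeight c (total ν) * pop (toForm ρ) ν - pop (toForm ρ) ν) :=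
        Finset.sum_congr rfl fun ν hν => by rw [hc ν hν]; ring
    _ ≤ _ := by
        refine Summable.sum_le_tsum s (fun ν _ => ?_)
          ((hρ.summable_logWeight hs c).sub hρ.hasSum_pop.summable)
        have := mul_nonneg (sub_nonneg.2 (one_le_logWeight c (total ν))) (pop_nonneg hρ.pos ν)
        linarith

end Density

/-- The energy is locally bounded along a solution, by a Gronwall estimate. -/
theorem IsSolution.exists_energy_le {n : ℕ}
    {H Γ : ℝ → Matrix (Idx n) (Idx n) ℂ} {f : ℝ → Idx n → ℂ}
    {ρ : ℝ → FockSpace n →L[ℂ] FockSpace n} (hsol : IsSolution H Γ f ρ)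
    (hH : ContinuousOn H (Set.Ici 0)) (hΓ : ContinuousOn Γ (Set.Ici 0))
    (hf : ContinuousOn f (Set.Ici 0)) (hρ : ∀ t : ℝ, 0 ≤ t → IsDensity (ρ t))
    (hs : ∀ t : ℝ, 0 ≤ t →
      Summable fun ν : Fin n → ℕ => ((total ν : ℝ) + 1) * pop (toForm (ρ t)) ν) (T : ℝ) :
    ∃ B, ∀ t ∈ Set.Icc 0 T, energy (toForm (ρ t)) ≤ B := by
  have hcont : ContinuousOn (fun t => coeffSize (H t) (Γ t) (f t)) (Set.Ici 0) := by
    have h1 : ∀ k l, ContinuousOn (fun t => H t k l) (Set.Ici 0) := fun k l =>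
      (continuous_apply_apply k l).comp_continuousOn hH
    have h2 : ∀ k l, ContinuousOn (fun t => Γ t k l) (Set.Ici 0) := fun k l =>
      (continuous_apply_apply k l).comp_continuousOn hΓ
    have h3 : ∀ k, ContinuousOn (fun t => f t k) (Set.Ici 0) := fun k =>
      (continuous_apply k).comp_continuousOn hf
    unfold coeffSize
    fun_prop
  obtain ⟨A, hA⟩ := (isCompact_Icc (a := (0 : ℝ)) (b := T)).exists_bound_of_continuousOn
    (hcont.mono Set.Icc_subset_Ici_self)
  -- `162 = 27 * 6`, from `norm_cutTrace_generator_le` and `slow_logCutoff`. The initial bound `N`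
  -- serves every `c` because the weight is at most `z + 2 ≤ 2 (z + 1)`.
  set K := 162 * A
  set N := ∑' ν, 2 * (((total ν : ℝ) + 1) * pop (toForm (ρ 0)) ν)
  have hg : Continuous (gronwallBound N K K) := continuous_iff_continuousAt.2 fun x =>
    (hasDerivAt_gronwallBound N K K x).continuousAt
  obtain ⟨B, hB⟩ := (isCompact_Icc (a := (0 : ℝ)) (b := T)).exists_bound_of_continuousOn
    hg.continuousOn
  refine ⟨B, fun t ht => (hρ t ht.1).energy_le (hs t ht.1) fun c => ?_⟩
  have hgr := norm_le_gronwallBound_of_norm_deriv_right_le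
    (f := fun s => cutTrace n (logCutoff c) (word [] (toForm (ρ s))))
    (f' := fun s => cutTrace n (logCutoff c)
      (word [] (generator (H s) (Γ s) (f s) (toForm (ρ s)))))
    (δ := N) (K := K) (ε := K) (a := 0) (b := T)
    ((hsol.continuousOn_cutTrace _ _).mono Set.Icc_subset_Ici_self)
    (fun s hs' => (hsol.hasDerivWithinAt_cutTrace _ _ hs'.1).mono
      (Set.Ici_subset_Ici.2 hs'.1)) ?_ ?_ t ht
  · rw [sub_zero] at hgr
    exact hgr.trans ((le_abs_self _).trans (hB t ht))
  · rw [(hρ 0 le_rfl).norm_cutTrace_logCutoff (hs 0 le_rfl)]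
    have : ∑' ν, logWeight c (total ν) * pop (toForm (ρ 0)) ν ≤ N := by
      refine ((hρ 0 le_rfl).summable_logWeight (hs 0 le_rfl) c).tsum_le_tsum (fun ν => ?_)
        ((hs 0 le_rfl).mul_left 2)
      rw [← mul_assoc]
      refine mul_le_mul_of_nonneg_right ((logWeight_le _ _).trans ?_)
        (pop_nonneg (hρ 0 le_rfl).pos _)
      linarith [((total ν).cast_nonneg : (0 : ℝ) ≤ total ν)]
    linarith
  · intro s hs'
    have h1 := norm_cutTrace_generator_le (doubling_logWeight c) (hρ s hs'.1).pos
      ((hρ s hs'.1).summable_logWeight (hs s hs'.1) c) (by norm_num) (slow_logCutoff c)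
      (H s) (Γ s) (f s)
    have h2 := (hρ s hs'.1).norm_cutTrace_logCutoff (hs s hs'.1) c
    have h3 : coeffSize (H s) (Γ s) (f s) ≤ A :=
      (le_abs_self _).trans (hA s ⟨hs'.1, hs'.2.le⟩)
    set S := ∑' ν, logWeight c (total ν) * pop (toForm (ρ s)) ν
    have h4 : 0 ≤ S := tsum_nonneg fun ν =>
      mul_nonneg ((doubling_logWeight c).nonneg _) (pop_nonneg (hρ s hs'.1).pos _)
    refine h1.trans ?_
    rw [h2]
    calc 27 * 6 * S * coeffSize (H s) (Γ s) (f s) ≤ 27 * 6 * S * A := by gcongr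
      _ = _ := by ring

/-! ### Differentiation of boundedly convergent sequences. -/

open Filter Topology

/-- `F R` converges to `L` pointwise on `[0, ∞)`, and is uniformly bounded on compact intervals. -/
structure BoundedLimit (F : ℕ → ℝ → ℂ) (L : ℝ → ℂ) : Prop where
  tendsto : ∀ t, 0 ≤ t → Tendsto (fun R => F R t) atTop (𝓝 (L t))
  bounded : ∀ T, ∃ C, ∀ R, ∀ t ∈ Set.Icc 0 T, ‖F R t‖ ≤ C

namespace BoundedLimit

variable {F G : ℕ → ℝ → ℂ} {L M : ℝ → ℂ}

theorem add (hF : BoundedLimit F L) (hG : BoundedLimit G M) :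
    BoundedLimit (fun R t => F R t + G R t) (fun t => L t + M t) where
  tendsto t ht := (hF.tendsto t ht).add (hG.tendsto t ht)
  bounded T := by
    obtain ⟨C, hC⟩ := hF.bounded T
    obtain ⟨D, hD⟩ := hG.bounded T
    exact ⟨C + D, fun R t ht => norm_add_le_of_le (hC R t ht) (hD R t ht)⟩

theorem mul_left {a : ℝ → ℂ} (ha : ContinuousOn a (Set.Ici 0)) (hF : BoundedLimit F L) :
    BoundedLimit (fun R t => a t * F R t) (fun t => a t * L t) where
  tendsto t ht := (hF.tendsto t ht).const_mul _
  bounded T := by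
    obtain ⟨C, hC⟩ := hF.bounded T
    obtain ⟨D, hD⟩ := (isCompact_Icc (a := (0 : ℝ)) (b := T)).exists_bound_of_continuousOn
      (ha.mono Set.Icc_subset_Ici_self)
    exact ⟨D * C, fun R t ht => norm_mul_le_of_le (hD t ht) (hC R t ht)⟩

theorem const_mul (c : ℂ) (hF : BoundedLimit F L) :
    BoundedLimit (fun R t => c * F R t) (fun t => c * L t) :=
  hF.mul_left (a := fun _ => c) continuousOn_const

theorem sub (hF : BoundedLimit F L) (hG : BoundedLimit G M) :
    BoundedLimit (fun R t => F R t - G R t) (fun t => L t - M t) := by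
  simpa [sub_eq_add_neg] using hF.add (hG.const_mul (-1))

theorem sum {ι : Type*} {s : Finset ι} {F : ι → ℕ → ℝ → ℂ} {L : ι → ℝ → ℂ}
    (h : ∀ i, BoundedLimit (F i) (L i)) :
    BoundedLimit (fun R t => ∑ i ∈ s, F i R t) (fun t => ∑ i ∈ s, L i t) where
  tendsto t ht := tendsto_finsetSum _ fun i _ => (h i).tendsto t ht
  bounded T := by
    choose C hC using fun i => (h i).bounded T
    exact ⟨∑ i ∈ s, C i, fun R t ht => norm_sum_le_of_le _ fun i _ => hC i R t ht⟩

theorem congr {F' : ℕ → ℝ → ℂ} {L' : ℝ → ℂ} (h : BoundedLimit F L)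
    (hF : ∀ R t, F' R t = F R t) (hL : ∀ t, L' t = L t) : BoundedLimit F' L' := by
  obtain rfl : F' = F := funext fun R => funext (hF R)
  obtain rfl : L' = L := funext hL
  exact h

/-- The derivatives are uniformly bounded on compact intervals, so the functions have a common
Lipschitz constant there, which passes to the pointwise limit. -/
theorem continuousOn {F' : ℕ → ℝ → ℂ} {L' : ℝ → ℂ} (hF : BoundedLimit F L)
    (hF' : BoundedLimit F' L')
    (hd : ∀ R t, 0 ≤ t → HasDerivWithinAt (F R) (F' R t) (Set.Ici 0) t) :
    ContinuousOn L (Set.Ici 0) := by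
  intro t ht
  obtain ⟨C, hC⟩ := hF'.bounded (t + 1)
  have hlip : LipschitzOnWith C.toNNReal L (Set.Icc 0 (t + 1)) := by
    refine LipschitzOnWith.of_dist_le_mul fun x hx y hy => ?_
    rw [dist_eq_norm, dist_eq_norm]
    have hlim := ((hF.tendsto x hx.1).sub (hF.tendsto y hy.1)).norm
    refine le_of_tendsto hlim (Eventually.of_forall fun R => ?_)
    refine (Convex.norm_image_sub_le_of_norm_hasDerivWithin_le
      (fun z hz => (hd R z hz.1).mono Set.Icc_subset_Ici_self) (hC R) (convex_Icc _ _)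
      hy hx).trans ?_
    exact mul_le_mul_of_nonneg_right (Real.le_coe_toNNReal _) (norm_nonneg _)
  have hmem : Set.Icc 0 (t + 1) ∈ 𝓝[Set.Ici 0] t := by
    rw [← Set.Ici_inter_Iic]
    exact inter_mem_nhdsWithin _ (Iic_mem_nhds (by linarith))
  exact ((hlip.continuousOn) t ⟨ht, by linarith⟩).mono_of_mem_nhdsWithin hmem

/-- The integrated identity passes to the limit by dominated convergence; continuity of `L'` then
allows it to be differentiated. -/
theorem hasDerivWithinAt {F' : ℕ → ℝ → ℂ} {L' : ℝ → ℂ} (hF : BoundedLimit F L)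
    (hF' : BoundedLimit F' L')
    (hd : ∀ R t, 0 ≤ t → HasDerivWithinAt (F R) (F' R t) (Set.Ici 0) t)
    (hc : ∀ R, ContinuousOn (F' R) (Set.Ici 0)) (hL' : ContinuousOn L' (Set.Ici 0))
    {t : ℝ} (ht : 0 ≤ t) : HasDerivWithinAt L (L' t) (Set.Ici 0) t := by
  have hint : ∀ s, 0 ≤ s → L s = L 0 + ∫ x in (0 : ℝ)..s, L' x := by
    intro s hs
    have hR : ∀ R, ∫ x in (0 : ℝ)..s, F' R x = F R s - F R 0 := fun R => by
      refine intervalIntegral.integral_eq_sub_of_hasDeriv_right_of_le hs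
        (fun x hx => ((hd R x hx.1).continuousWithinAt).mono Set.Icc_subset_Ici_self)
        (fun x hx => (hd R x hx.1.le).mono fun y hy => ?_) ?_
      · exact hx.1.le.trans (le_of_lt hy)
      · refine ContinuousOn.intervalIntegrable ?_
        rw [Set.uIcc_of_le hs]
        exact (hc R).mono Set.Icc_subset_Ici_self
    obtain ⟨C, hC⟩ := hF'.bounded s
    have h1 : Tendsto (fun R => ∫ x in (0 : ℝ)..s, F' R x) atTop
        (𝓝 (∫ x in (0 : ℝ)..s, L' x)) := by
      refine intervalIntegral.tendsto_integral_filter_of_dominated_convergence (fun _ => C)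
        (Eventually.of_forall fun R => ?_) (Eventually.of_forall fun R => ?_)
        intervalIntegrable_const ?_
      · rw [Set.uIoc_of_le hs]
        exact ((hc R).mono fun x hx => hx.1.le).aestronglyMeasurable measurableSet_Ioc
      · refine Eventually.of_forall fun x hx => ?_
        rw [Set.uIoc_of_le hs] at hx
        exact hC R x ⟨hx.1.le, hx.2⟩
      · refine Eventually.of_forall fun x hx => ?_
        rw [Set.uIoc_of_le hs] at hx
        exact hF'.tendsto x hx.1.le
    simp only [hR] at h1
    have h2 := tendsto_nhds_unique h1 ((hF.tendsto s hs).sub (hF.tendsto 0 le_rfl))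
    rw [h2]
    ring
  -- The constant extension to negative times gives a two-sided derivative, which covers `t = 0` as
  -- well.
  have hg : Continuous fun x => L' (max x 0) :=
    hL'.comp_continuous (by fun_prop) fun x => Set.mem_Ici.2 (le_max_right _ _)
  have hder := ((hg.integral_hasStrictDerivAt 0 t).hasDerivAt.const_add (L 0)).hasDerivWithinAt
    (s := Set.Ici 0)
  rw [max_eq_left ht] at hder
  have heq : ∀ s, 0 ≤ s → L s = L 0 + ∫ x in (0 : ℝ)..s, L' (max x 0) := fun s hs => by
    rw [hint s hs]
    congr 1
    refine intervalIntegral.integral_congr fun x hx => ?_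
    rw [Set.uIcc_of_le hs] at hx
    simp only [max_eq_left hx.1]
  exact hder.congr (fun s hs => heq s hs) (heq t ht)

end BoundedLimit

/-! ### Cut-offs tending to one. -/

/-- A family of density matrices whose energies are locally bounded. -/
structure LocallyBoundedEnergy {n : ℕ} (ρ : ℝ → FockSpace n →L[ℂ] FockSpace n) : Prop where
  density : ∀ t, 0 ≤ t → IsDensity (ρ t)
  summable : ∀ t, 0 ≤ t →
    Summable fun ν : Fin n → ℕ => ((total ν : ℝ) + 1) * pop (toForm (ρ t)) ν
  energy_le : ∀ T, ∃ B, ∀ t ∈ Set.Icc 0 T, energy (toForm (ρ t)) ≤ B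

theorem doubling_add_one : Doubling fun z => (z : ℝ) + 1 where
  nonneg z := by positivity
  succ_le z := by push_cast; linarith [(z.cast_nonneg : (0 : ℝ) ≤ z)]
  le_succ z := by push_cast; linarith [(z.cast_nonneg : (0 : ℝ) ≤ z)]

/-- Cut-offs which converge boundedly to one. -/
structure ApproxOne (η : ℕ → Cutoff) : Prop where
  norm_le : ∀ R z, ‖(η R : ℕ → ℂ) z‖ ≤ 1
  tendsto : ∀ z, Tendsto (fun R => (η R : ℕ → ℂ) z) atTop (𝓝 1)

theorem ApproxOne.shift {n : ℕ} {η : ℕ → Cutoff} (h : ApproxOne η) (k : Idx n) :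
    ApproxOne fun R => shift k (η R) where
  norm_le R _ := h.norm_le R _
  tendsto _ := h.tendsto _

/-- Cut-offs which converge to zero and decay like `1 / z`. -/
structure ApproxZero (η : ℕ → Cutoff) : Prop where
  norm_le : ∀ R (z : ℕ), ‖(η R : ℕ → ℂ) z‖ * ((z : ℝ) + 1) ≤ 8
  tendsto : ∀ z, Tendsto (fun R => (η R : ℕ → ℂ) z) atTop (𝓝 0)

/-- The trace of a form, with respect to the number states. -/
def trace {n : ℕ} (σ : Form n) : ℂ := ∑' ν, σ (numberState ν) (numberState ν)

section Limits

variable {n : ℕ} {ρ : ℝ → FockSpace n →L[ℂ] FockSpace n} {η : ℕ → Cutoff}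

theorem LocallyBoundedEnergy.boundedLimit (hρ : LocallyBoundedEnergy ρ) (w : List (Idx n))
    {h : ℕ → ℂ} (hlim : ∀ z, Tendsto (fun R => (η R : ℕ → ℂ) z) atTop (𝓝 (h z)))
    {C : ℝ} (hC : 0 ≤ C)
    (hh : ∀ R (z : ℕ), ‖(η R : ℕ → ℂ) z‖ * √(((z : ℝ) + w.length) ^ w.length) ≤ C * (z + 1)) :
    BoundedLimit (fun R t => cutTrace n (η R) (word w (toForm (ρ t))))
      (fun t => ∑' ν, h (total ν) * word w (toForm (ρ t)) (numberState ν) (numberState ν)) where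
  tendsto t ht := tendsto_cutTrace_word doubling_add_one (hρ.density t ht).pos
    (hρ.summable t ht) w η hlim hh
  bounded T := by
    obtain ⟨B, hB⟩ := hρ.energy_le T
    refine ⟨C * (3 ^ w.length * B), fun R t ht => ?_⟩
    refine (norm_cutTrace_word_le doubling_add_one (hρ.density t ht.1).pos
      (hρ.summable t ht.1) w (η R) hC (hh R)).trans ?_
    have := hB t ht
    rw [energy] at this
    gcongr

theorem ApproxOne.boundedLimit (hη : ApproxOne η) (hρ : LocallyBoundedEnergy ρ)
    (w : List (Idx n)) (hw : w.length ≤ 2) :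
    BoundedLimit (fun R t => cutTrace n (η R) (word w (toForm (ρ t))))
      (fun t => trace (word w (toForm (ρ t)))) := by
  refine (hρ.boundedLimit w (h := fun _ => 1) hη.tendsto (C := 2) (by norm_num)
    fun R z => ?_).congr (fun _ _ => rfl) fun t => by simp [trace]
  refine mul_sqrt_le_of_length_le_two (norm_nonneg _) hw ?_
  exact mul_le_of_le_one_left (by positivity) (hη.norm_le R z)

/-- Four letters grow like `N ^ 2` and the cut-off decays like `1 / N`, so the energy dominates.
Moments of third and fourth order need not exist. -/
theorem ApproxZero.boundedLimit (hη : ApproxZero η) (hρ : LocallyBoundedEnergy ρ)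
    (w : List (Idx n)) (hw : w.length ≤ 4) :
    BoundedLimit (fun R t => cutTrace n (η R) (word w (toForm (ρ t)))) (fun _ => 0) := by
  refine (hρ.boundedLimit w (h := fun _ => 0) hη.tendsto (C := 16 * 8) (by norm_num)
    fun R z => ?_).congr (fun _ _ => rfl) fun t => by simp
  exact mul_sqrt_le_of_length_le_four (norm_nonneg _) hw (hη.norm_le R z)

end Limits

/-- The cut-off which decreases linearly from one at zero to zero at `R + 1`. -/
def linCutoff (R : ℕ) : Cutoff :=
  ⟨fun z => ((max 0 (1 - (z : ℝ) / (R + 1)) : ℝ) : ℂ), R + 1, fun z hz => by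
    have h1 : ((R : ℝ) + 1) ≤ z := by exact_mod_cast hz
    have h2 : 1 ≤ (z : ℝ) / (R + 1) := (one_le_div (by positivity)).2 h1
    simp only [max_eq_left (sub_nonpos.2 h2), Complex.ofReal_zero]⟩

theorem approxOne_linCutoff : ApproxOne linCutoff where
  norm_le R z := by
    simp only [linCutoff, Complex.norm_real, Real.norm_eq_abs]
    rw [abs_of_nonneg (le_max_left _ _)]
    refine max_le zero_le_one ?_
    have : 0 ≤ (z : ℝ) / (R + 1) := by positivity
    linarith
  tendsto z := by
    have h1 : Tendsto (fun R : ℕ => (z : ℝ) * (1 / ((R : ℝ) + 1))) atTop (𝓝 (z * 0)) :=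
      tendsto_one_div_add_atTop_nhds_zero_nat.const_mul _
    have h2 : Tendsto (fun R : ℕ => max 0 (1 - (z : ℝ) * (1 / ((R : ℝ) + 1)))) atTop
        (𝓝 (max 0 (1 - z * 0))) := tendsto_const_nhds.max (tendsto_const_nhds.sub h1)
    have h3 := (Complex.continuous_ofReal.tendsto _).comp h2
    simpa [linCutoff, Function.comp_def, div_eq_mul_inv] using h3

/-- Both values vanish for `z ≥ R + 3`; below that, the Lipschitz bound `2 / (R + 1)` meets `z + 1 ≤
4 (R + 1)`. -/
theorem slow_linCutoff (R : ℕ) : Slow (linCutoff R) 8 fun _ => 1 := by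
  intro x z h1 h2
  have hR : (0 : ℝ) < R + 1 := by positivity
  have h1' : (x : ℝ) ≤ z + 2 := by exact_mod_cast h1
  have h2' : (z : ℝ) ≤ x + 2 := by exact_mod_cast h2
  have hz : (0 : ℝ) ≤ z := z.cast_nonneg
  simp only [linCutoff]
  rw [← Complex.ofReal_sub, Complex.norm_real, Real.norm_eq_abs, mul_one]
  rcases le_total ((R : ℝ) + 3) z with h | h
  · have hx : 1 ≤ (x : ℝ) / (R + 1) := (one_le_div hR).2 (by linarith)
    have hz' : 1 ≤ (z : ℝ) / (R + 1) := (one_le_div hR).2 (by linarith)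
    rw [max_eq_left (by linarith), max_eq_left (by linarith)]
    simp
  · have h3 : |max 0 (1 - (x : ℝ) / (R + 1)) - max 0 (1 - (z : ℝ) / (R + 1))| ≤ 2 / (R + 1) := by
      refine (abs_max_sub_max_le_max _ _ _ _).trans (max_le (by simp; positivity) ?_)
      rw [sub_sub_sub_cancel_left, ← sub_div, abs_div, abs_of_pos hR]
      gcongr
      exact abs_sub_le_iff.2 ⟨by linarith, by linarith⟩
    calc _ ≤ 2 / ((R : ℝ) + 1) * (4 * (R + 1)) := by
          refine mul_le_mul h3 ?_ (by positivity) (by positivity)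
          linarith [(R.cast_nonneg : (0 : ℝ) ≤ R)]
      _ = 8 := by field_simp; norm_num

theorem approxZero_sub_shift {n : ℕ} (k : Idx n) :
    ApproxZero fun R => linCutoff R - shift k (linCutoff R) where
  norm_le R z := by simpa using (slow_linCutoff R).sub_shift k z
  tendsto z := by
    simpa using (approxOne_linCutoff.tendsto z).sub ((approxOne_linCutoff.shift k).tendsto z)

theorem approxZero_sub_shift_shift {n : ℕ} (k l : Idx n) :
    ApproxZero fun R => linCutoff R - shift k (shift l (linCutoff R)) where
  norm_le R z := by simpa using (slow_linCutoff R).sub_shift_shift k l z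
  tendsto z := by
    simpa using (approxOne_linCutoff.tendsto z).sub
      (((approxOne_linCutoff.shift l).shift k).tendsto z)

open Matrix

/-! ### Reordering the words: long words with small cut-offs, plus commutators. -/

section Commutators

variable {n : ℕ} (σ : Form n) (χ : Cutoff)

theorem word_swap (k l : Idx n) (w : List (Idx n)) :
    word (k :: l :: w) σ = word (l :: k :: w) σ + J (Fin n) ℂ l k • word w σ := by
  simp only [word_cons]
  exact leftMul_leftMul k l _

theorem leftMul_add_smul (k : Idx n) (σ τ : Form n) (c : ℂ) :
    leftMul k (σ + c • τ) = leftMul k σ + c • leftMul k τ := rfl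

theorem word_commute_one (k p : Idx n) :
    word [k, p] σ = word [p, k] σ + J (Fin n) ℂ p k • word [] σ :=
  word_swap σ k p []

theorem word_commute_two (k p q : Idx n) (w : List (Idx n)) :
    word (k :: p :: q :: w) σ = word (p :: q :: k :: w) σ + J (Fin n) ℂ q k • word (p :: w) σ
      + J (Fin n) ℂ p k • word (q :: w) σ := by
  rw [word_swap, word_cons p (k :: q :: w), word_swap, leftMul_add_smul, ← word_cons, ← word_cons]

theorem hamTerm_one (p k l : Idx n) :
    hamTerm χ [p] σ k l = cutTrace n (χ - shift k (shift l χ)) (word [p, k, l] σ)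
      - (J (Fin n) ℂ p k * cutTrace n (shift k (shift l χ)) (word [l] σ)
        + J (Fin n) ℂ p l * cutTrace n (shift k (shift l χ)) (word [k] σ)) := by
  have h : word [k, l, p] σ = word [p, k, l] σ + J (Fin n) ℂ p k • word [l] σ
      + J (Fin n) ℂ p l • word [k] σ := by
    rw [word_cons, word_commute_one, leftMul_add_smul, ← word_cons, word_swap]
    simp only [word_cons]
  simp only [hamTerm, List.cons_append, List.nil_append, h, map_add, map_sub, map_smul,
    LinearMap.sub_apply, smul_eq_mul]
  ring

theorem driveTerm_one (p k : Idx n) :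
    driveTerm χ [p] σ k = cutTrace n (χ - shift k χ) (word [p, k] σ)
      - J (Fin n) ℂ p k * cutTrace n (shift k χ) (word [] σ) := by
  simp only [driveTerm, List.cons_append, List.nil_append, word_commute_one σ k p, map_add,
    map_sub, map_smul, LinearMap.sub_apply, smul_eq_mul]
  ring

/-- Once all three words are reordered to `[p, l, k]`, their weights `1`, `-1 / 2`, `-1 / 2` sum to
zero, so the cut-offs combine into differences. -/
theorem dissTerm_one (p k l : Idx n) :
    dissTerm χ [p] σ k l = 1 / 2 * cutTrace n (χ - shift l (shift k χ)) (word [p, l, k] σ)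
      - cutTrace n (χ - shift l χ) (word [p, l, k] σ)
      + (J (Fin n) ℂ p l * cutTrace n (shift l χ) (word [k] σ)
        - 1 / 2 * (J (Fin n) ℂ p l * cutTrace n (shift l (shift k χ)) (word [k] σ)
          + J (Fin n) ℂ p k * cutTrace n (shift l (shift k χ)) (word [l] σ))) := by
  have h1 : word [l, p, k] σ = word [p, l, k] σ + J (Fin n) ℂ p l • word [k] σ :=
    word_swap σ l p [k]
  have h2 : word [l, k, p] σ = word [p, l, k] σ + J (Fin n) ℂ p l • word [k] σ
      + J (Fin n) ℂ p k • word [l] σ := by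
    rw [word_cons, word_commute_one, leftMul_add_smul, ← word_cons, word_swap]
    simp only [word_cons]
  simp only [dissTerm, List.cons_append, List.nil_append, h1, h2, map_add, map_sub, map_smul,
    LinearMap.sub_apply, smul_eq_mul]
  ring

theorem word_commute_two_two (k l p q : Idx n) :
    word [k, l, p, q] σ = word [p, q, k, l] σ
      + (J (Fin n) ℂ q k • word [p, l] σ + J (Fin n) ℂ p k • word [q, l] σ
        + J (Fin n) ℂ q l • word [k, p] σ + J (Fin n) ℂ p l • word [k, q] σ) := by
  rw [word_cons, word_commute_two σ l p q [], leftMul_add_smul, leftMul_add_smul,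
    ← word_cons, ← word_cons, ← word_cons, word_commute_two σ k p q [l]]
  abel

theorem hamTerm_two (p q k l : Idx n) :
    hamTerm χ [p, q] σ k l = cutTrace n (χ - shift k (shift l χ)) (word [p, q, k, l] σ)
      - (J (Fin n) ℂ q k * cutTrace n (shift k (shift l χ)) (word [p, l] σ)
        + J (Fin n) ℂ p k * cutTrace n (shift k (shift l χ)) (word [q, l] σ)
        + J (Fin n) ℂ q l * cutTrace n (shift k (shift l χ)) (word [k, p] σ)
        + J (Fin n) ℂ p l * cutTrace n (shift k (shift l χ)) (word [k, q] σ)) := by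
  simp only [hamTerm, List.cons_append, List.nil_append, word_commute_two_two σ k l p q, map_add,
    map_sub, map_smul, LinearMap.sub_apply, smul_eq_mul]
  ring

theorem driveTerm_two (p q k : Idx n) :
    driveTerm χ [p, q] σ k = cutTrace n (χ - shift k χ) (word [p, q, k] σ)
      - (J (Fin n) ℂ q k * cutTrace n (shift k χ) (word [p] σ)
        + J (Fin n) ℂ p k * cutTrace n (shift k χ) (word [q] σ)) := by
  simp only [driveTerm, List.cons_append, List.nil_append, word_commute_two σ k p q, map_add,
    map_sub, map_smul, LinearMap.sub_apply, smul_eq_mul]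
  ring

theorem dissTerm_two (p q k l : Idx n) :
    dissTerm χ [p, q] σ k l
      = 1 / 2 * cutTrace n (χ - shift l (shift k χ)) (word [p, q, l, k] σ)
      - cutTrace n (χ - shift l χ) (word [p, q, l, k] σ)
      + ((J (Fin n) ℂ q l * cutTrace n (shift l χ) (word [p, k] σ)
          + J (Fin n) ℂ p l * cutTrace n (shift l χ) (word [q, k] σ))
        - 1 / 2 * (J (Fin n) ℂ q l * cutTrace n (shift l (shift k χ)) (word [p, k] σ)
          + J (Fin n) ℂ p l * cutTrace n (shift l (shift k χ)) (word [q, k] σ)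
          + J (Fin n) ℂ q k * cutTrace n (shift l (shift k χ)) (word [l, p] σ)
          + J (Fin n) ℂ p k * cutTrace n (shift l (shift k χ)) (word [l, q] σ))) := by
  simp only [dissTerm, List.cons_append, List.nil_append, word_commute_two_two σ l k p q,
    word_commute_two σ l p q [k], map_add, map_sub, map_smul, LinearMap.sub_apply, smul_eq_mul]
  ring

end Commutators

/-! ### Limits of the contributions of the coefficients. -/

section Limits

variable {n : ℕ} {ρ : ℝ → FockSpace n →L[ℂ] FockSpace n}

/-- The matrix of second moments `tr (𝔞 𝔞ᵀ σ)`. -/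
def secondMoment (σ : Form n) : Matrix (Idx n) (Idx n) ℂ :=
  Matrix.of fun k l => trace (word [k, l] σ)

/-- The vector of first moments `tr (𝔞 σ)`. -/
def firstMoment (σ : Form n) : Idx n → ℂ := fun k => trace (word [k] σ)

theorem LocallyBoundedEnergy.cutTrace_one (hρ : LocallyBoundedEnergy ρ) {η : ℕ → Cutoff}
    (hη : ApproxOne η) (k : Idx n) :
    BoundedLimit (fun R t => cutTrace n (η R) (word [k] (toForm (ρ t))))
      (fun t => firstMoment (toForm (ρ t)) k) :=
  hη.boundedLimit hρ [k] (by simp)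

theorem LocallyBoundedEnergy.cutTrace_two (hρ : LocallyBoundedEnergy ρ) {η : ℕ → Cutoff}
    (hη : ApproxOne η) (k l : Idx n) :
    BoundedLimit (fun R t => cutTrace n (η R) (word [k, l] (toForm (ρ t))))
      (fun t => secondMoment (toForm (ρ t)) k l) :=
  hη.boundedLimit hρ [k, l] (by simp)

/-- The explicit `0`, here and in the analogous statements below, is the limit of the long words. It
is left unsimplified so that the limit matches the algebraic identity term by term. -/
theorem LocallyBoundedEnergy.hamTerm_one (hρ : LocallyBoundedEnergy ρ) (p k l : Idx n) :
    BoundedLimit (fun R t => hamTerm (linCutoff R) [p] (toForm (ρ t)) k l)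
      (fun t => 0 - (J (Fin n) ℂ p k * firstMoment (toForm (ρ t)) l
        + J (Fin n) ℂ p l * firstMoment (toForm (ρ t)) k)) := by
  have h := (approxOne_linCutoff.shift l).shift k
  exact (((approxZero_sub_shift_shift k l).boundedLimit hρ _ (by simp)).sub
    (((hρ.cutTrace_one h l).const_mul _).add ((hρ.cutTrace_one h k).const_mul _))).congr
      (fun R t => BosonicGKSL.hamTerm_one _ _ p k l) fun t => rfl

theorem LocallyBoundedEnergy.driveTerm_one (hρ : LocallyBoundedEnergy ρ) (p k : Idx n) :
    BoundedLimit (fun R t => driveTerm (linCutoff R) [p] (toForm (ρ t)) k)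
      (fun t => 0 - J (Fin n) ℂ p k * trace (word [] (toForm (ρ t)))) :=
  (((approxZero_sub_shift k).boundedLimit hρ _ (by simp)).sub
    (((approxOne_linCutoff.shift k).boundedLimit hρ [] (by simp)).const_mul _)).congr
      (fun R t => BosonicGKSL.driveTerm_one _ _ p k) fun t => rfl

theorem LocallyBoundedEnergy.dissTerm_one (hρ : LocallyBoundedEnergy ρ) (p k l : Idx n) :
    BoundedLimit (fun R t => dissTerm (linCutoff R) [p] (toForm (ρ t)) k l)
      (fun t => 1 / 2 * 0 - 0 + (J (Fin n) ℂ p l * firstMoment (toForm (ρ t)) k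
        - 1 / 2 * (J (Fin n) ℂ p l * firstMoment (toForm (ρ t)) k
          + J (Fin n) ℂ p k * firstMoment (toForm (ρ t)) l))) := by
  have h1 := approxOne_linCutoff.shift l
  have h2 := (approxOne_linCutoff.shift k).shift l
  exact (((((approxZero_sub_shift_shift l k).boundedLimit hρ _ (by simp)).const_mul _).sub
    ((approxZero_sub_shift l).boundedLimit hρ _ (by simp))).add
      (((hρ.cutTrace_one h1 k).const_mul _).sub
        ((((hρ.cutTrace_one h2 k).const_mul _).add
          ((hρ.cutTrace_one h2 l).const_mul _)).const_mul _))).congr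
    (fun R t => BosonicGKSL.dissTerm_one _ _ p k l) fun t => rfl

theorem LocallyBoundedEnergy.hamTerm_two (hρ : LocallyBoundedEnergy ρ) (p q k l : Idx n) :
    BoundedLimit (fun R t => hamTerm (linCutoff R) [p, q] (toForm (ρ t)) k l)
      (fun t => 0 - (J (Fin n) ℂ q k * secondMoment (toForm (ρ t)) p l
        + J (Fin n) ℂ p k * secondMoment (toForm (ρ t)) q l
        + J (Fin n) ℂ q l * secondMoment (toForm (ρ t)) k p
        + J (Fin n) ℂ p l * secondMoment (toForm (ρ t)) k q)) := by
  have h := (approxOne_linCutoff.shift l).shift k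
  exact (((approxZero_sub_shift_shift k l).boundedLimit hρ _ (by simp)).sub
    (((((hρ.cutTrace_two h p l).const_mul _).add ((hρ.cutTrace_two h q l).const_mul _)).add
      ((hρ.cutTrace_two h k p).const_mul _)).add ((hρ.cutTrace_two h k q).const_mul _))).congr
      (fun R t => BosonicGKSL.hamTerm_two _ _ p q k l) fun t => rfl

theorem LocallyBoundedEnergy.driveTerm_two (hρ : LocallyBoundedEnergy ρ) (p q k : Idx n) :
    BoundedLimit (fun R t => driveTerm (linCutoff R) [p, q] (toForm (ρ t)) k)
      (fun t => 0 - (J (Fin n) ℂ q k * firstMoment (toForm (ρ t)) p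
        + J (Fin n) ℂ p k * firstMoment (toForm (ρ t)) q)) := by
  have h := approxOne_linCutoff.shift k
  exact (((approxZero_sub_shift k).boundedLimit hρ _ (by simp)).sub
    (((hρ.cutTrace_one h p).const_mul _).add ((hρ.cutTrace_one h q).const_mul _))).congr
      (fun R t => BosonicGKSL.driveTerm_two _ _ p q k) fun t => rfl

theorem LocallyBoundedEnergy.dissTerm_two (hρ : LocallyBoundedEnergy ρ) (p q k l : Idx n) :
    BoundedLimit (fun R t => dissTerm (linCutoff R) [p, q] (toForm (ρ t)) k l)
      (fun t => 1 / 2 * 0 - 0 + ((J (Fin n) ℂ q l * secondMoment (toForm (ρ t)) p k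
          + J (Fin n) ℂ p l * secondMoment (toForm (ρ t)) q k)
        - 1 / 2 * (J (Fin n) ℂ q l * secondMoment (toForm (ρ t)) p k
          + J (Fin n) ℂ p l * secondMoment (toForm (ρ t)) q k
          + J (Fin n) ℂ q k * secondMoment (toForm (ρ t)) l p
          + J (Fin n) ℂ p k * secondMoment (toForm (ρ t)) l q))) := by
  have h1 := approxOne_linCutoff.shift l
  have h2 := (approxOne_linCutoff.shift k).shift l
  exact (((((approxZero_sub_shift_shift l k).boundedLimit hρ _ (by simp)).const_mul _).sub
    ((approxZero_sub_shift l).boundedLimit hρ _ (by simp))).add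
      ((((hρ.cutTrace_two h1 p k).const_mul _).add ((hρ.cutTrace_two h1 q k).const_mul _)).sub
        ((((((hρ.cutTrace_two h2 p k).const_mul _).add
          ((hρ.cutTrace_two h2 q k).const_mul _)).add
          ((hρ.cutTrace_two h2 l p).const_mul _)).add
          ((hρ.cutTrace_two h2 l q).const_mul _)).const_mul _))).congr
    (fun R t => BosonicGKSL.dissTerm_two _ _ p q k l) fun t => rfl

end Limits

/-! ### Evolution of the moments. -/

section Evolution

variable {n : ℕ} {H Γ : ℝ → Matrix (Idx n) (Idx n) ℂ} {f : ℝ → Idx n → ℂ}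
  {ρ : ℝ → FockSpace n →L[ℂ] FockSpace n}

/-- The sum over the coefficients of a generator of given contributions. -/
def coeffSum (H Γ : Matrix (Idx n) (Idx n) ℂ) (f : Idx n → ℂ) (a : Idx n → Idx n → ℂ)
    (b : Idx n → ℂ) (c : Idx n → Idx n → ℂ) : ℂ :=
  ∑ k, ∑ l, (-Complex.I / 2 * H k l) * a k l + ∑ k, (-Complex.I * f k) * b k
    + ∑ k, ∑ l, Γ k l * c k l

theorem continuousOn_coeffSum (hH : ContinuousOn H (Set.Ici 0))
    (hΓ : ContinuousOn Γ (Set.Ici 0)) (hf : ContinuousOn f (Set.Ici 0))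
    {a c : ℝ → Idx n → Idx n → ℂ} {b : ℝ → Idx n → ℂ}
    (ha : ∀ k l, ContinuousOn (fun t => a t k l) (Set.Ici 0))
    (hb : ∀ k, ContinuousOn (fun t => b t k) (Set.Ici 0))
    (hc : ∀ k l, ContinuousOn (fun t => c t k l) (Set.Ici 0)) :
    ContinuousOn (fun t => coeffSum (H t) (Γ t) (f t) (a t) (b t) (c t)) (Set.Ici 0) := by
  have h1 : ∀ k l, ContinuousOn (fun t => H t k l) (Set.Ici 0) := fun k l =>
    (continuous_apply_apply k l).comp_continuousOn hH
  have h2 : ∀ k l, ContinuousOn (fun t => Γ t k l) (Set.Ici 0) := fun k l =>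
    (continuous_apply_apply k l).comp_continuousOn hΓ
  have h3 : ∀ k, ContinuousOn (fun t => f t k) (Set.Ici 0) := fun k =>
    (continuous_apply k).comp_continuousOn hf
  unfold coeffSum
  fun_prop

theorem BoundedLimit.coeffSum (hH : ContinuousOn H (Set.Ici 0))
    (hΓ : ContinuousOn Γ (Set.Ici 0)) (hf : ContinuousOn f (Set.Ici 0))
    {A C : ℕ → ℝ → Idx n → Idx n → ℂ} {B : ℕ → ℝ → Idx n → ℂ}
    {a c : ℝ → Idx n → Idx n → ℂ} {b : ℝ → Idx n → ℂ}
    (ha : ∀ k l, BoundedLimit (fun R t => A R t k l) (fun t => a t k l))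
    (hb : ∀ k, BoundedLimit (fun R t => B R t k) (fun t => b t k))
    (hc : ∀ k l, BoundedLimit (fun R t => C R t k l) (fun t => c t k l)) :
    BoundedLimit (fun R t => BosonicGKSL.coeffSum (H t) (Γ t) (f t) (A R t) (B R t) (C R t))
      (fun t => BosonicGKSL.coeffSum (H t) (Γ t) (f t) (a t) (b t) (c t)) := by
  have h1 : ∀ k l, ContinuousOn (fun t => -Complex.I / 2 * H t k l) (Set.Ici 0) := fun k l =>
    continuousOn_const.mul ((continuous_apply_apply k l).comp_continuousOn hH)
  have h2 : ∀ k l, ContinuousOn (fun t => Γ t k l) (Set.Ici 0) := fun k l =>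
    (continuous_apply_apply k l).comp_continuousOn hΓ
  have h3 : ∀ k, ContinuousOn (fun t => -Complex.I * f t k) (Set.Ici 0) := fun k =>
    continuousOn_const.mul ((continuous_apply k).comp_continuousOn hf)
  exact ((BoundedLimit.sum fun k => BoundedLimit.sum fun l => (ha k l).mul_left (h1 k l)).add
    (BoundedLimit.sum fun k => (hb k).mul_left (h3 k))).add
    (BoundedLimit.sum fun k => BoundedLimit.sum fun l => (hc k l).mul_left (h2 k l))

theorem IsSolution.continuousOn_generator (hsol : IsSolution H Γ f ρ)
    (hH : ContinuousOn H (Set.Ici 0)) (hΓ : ContinuousOn Γ (Set.Ici 0))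
    (hf : ContinuousOn f (Set.Ici 0)) (χ : Cutoff) (w : List (Idx n)) :
    ContinuousOn (fun t => cutTrace n χ (word w (generator (H t) (Γ t) (f t) (toForm (ρ t)))))
      (Set.Ici 0) := by
  simp only [cutTrace_word_generator]
  have h := hsol.continuousOn_cutTrace
  exact continuousOn_coeffSum hH hΓ hf
    (a := fun t k l => hamTerm χ w (toForm (ρ t)) k l)
    (b := fun t k => driveTerm χ w (toForm (ρ t)) k)
    (c := fun t k l => dissTerm χ w (toForm (ρ t)) k l)
    (fun k l => (h _ _).sub (h _ _)) (fun k => (h _ _).sub (h _ _))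
    (fun k l => ((h _ _).sub (continuousOn_const.mul (h _ _))).sub
      (continuousOn_const.mul (h _ _)))

/-- The limiting derivatives are combinations of moments with continuous coefficients. Continuity of
the moments must come before their differentiability, since `IsSolution.hasDerivWithinAt_trace`
takes it as input. -/
theorem IsSolution.continuousOn_trace (hsol : IsSolution H Γ f ρ)
    (hH : ContinuousOn H (Set.Ici 0)) (hΓ : ContinuousOn Γ (Set.Ici 0))
    (hf : ContinuousOn f (Set.Ici 0)) (hρ : LocallyBoundedEnergy ρ) {w : List (Idx n)}
    (hw : w.length ≤ 2) {a c : ℝ → Idx n → Idx n → ℂ} {b : ℝ → Idx n → ℂ}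
    (ha : ∀ k l, BoundedLimit (fun R t => hamTerm (linCutoff R) w (toForm (ρ t)) k l)
      (fun t => a t k l))
    (hb : ∀ k, BoundedLimit (fun R t => driveTerm (linCutoff R) w (toForm (ρ t)) k)
      (fun t => b t k))
    (hc : ∀ k l, BoundedLimit (fun R t => dissTerm (linCutoff R) w (toForm (ρ t)) k l)
      (fun t => c t k l)) :
    ContinuousOn (fun t => trace (word w (toForm (ρ t)))) (Set.Ici 0) :=
  (approxOne_linCutoff.boundedLimit hρ w hw).continuousOn
    ((BoundedLimit.coeffSum hH hΓ hf ha hb hc).congr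
      (fun _ _ => cutTrace_word_generator _ _ _ _ _ _) fun _ => rfl)
    (fun _ _ ht => hsol.hasDerivWithinAt_cutTrace _ _ ht)

theorem IsSolution.hasDerivWithinAt_trace (hsol : IsSolution H Γ f ρ)
    (hH : ContinuousOn H (Set.Ici 0)) (hΓ : ContinuousOn Γ (Set.Ici 0))
    (hf : ContinuousOn f (Set.Ici 0)) (hρ : LocallyBoundedEnergy ρ) {w : List (Idx n)}
    (hw : w.length ≤ 2) {a c : ℝ → Idx n → Idx n → ℂ} {b : ℝ → Idx n → ℂ}
    (ha : ∀ k l, BoundedLimit (fun R t => hamTerm (linCutoff R) w (toForm (ρ t)) k l)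
      (fun t => a t k l))
    (hb : ∀ k, BoundedLimit (fun R t => driveTerm (linCutoff R) w (toForm (ρ t)) k)
      (fun t => b t k))
    (hc : ∀ k l, BoundedLimit (fun R t => dissTerm (linCutoff R) w (toForm (ρ t)) k l)
      (fun t => c t k l))
    (ha' : ∀ k l, ContinuousOn (fun t => a t k l) (Set.Ici 0))
    (hb' : ∀ k, ContinuousOn (fun t => b t k) (Set.Ici 0))
    (hc' : ∀ k l, ContinuousOn (fun t => c t k l) (Set.Ici 0)) {t : ℝ} (ht : 0 ≤ t) :
    HasDerivWithinAt (fun t => trace (word w (toForm (ρ t))))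
      (coeffSum (H t) (Γ t) (f t) (a t) (b t) (c t)) (Set.Ici 0) t :=
  (approxOne_linCutoff.boundedLimit hρ w hw).hasDerivWithinAt
    ((BoundedLimit.coeffSum hH hΓ hf ha hb hc).congr
      (fun _ _ => cutTrace_word_generator _ _ _ _ _ _) fun _ => rfl)
    (fun _ _ ht => hsol.hasDerivWithinAt_cutTrace _ _ ht)
    (fun _ => hsol.continuousOn_generator hH hΓ hf _ _)
    (continuousOn_coeffSum hH hΓ hf ha' hb' hc') ht

end Evolution

/-! ### Matrix form of the limiting equations. -/

section Algebra

variable {n : ℕ} (H Γ : Matrix (Idx n) (Idx n) ℂ) (f m : Idx n → ℂ)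
  (M : Matrix (Idx n) (Idx n) ℂ)

/-- The matrix which drives the linear part of the equation of the mean. -/
def drift : Matrix (Idx n) (Idx n) ℂ :=
  J (Fin n) ℂ * (Complex.I • H + (1 / 2 : ℂ) • (Γ.transpose - Γ))

theorem mul_mul_apply_eq_sum (A B C : Matrix (Idx n) (Idx n) ℂ) (p q : Idx n) :
    (A * B * C) p q = ∑ k, ∑ l, A p k * B k l * C l q := by
  rw [Matrix.mul_assoc, Matrix.mul_apply]
  simp only [Matrix.mul_apply, Finset.mul_sum, mul_assoc]

theorem mul_mulVec_apply_eq_sum (A B : Matrix (Idx n) (Idx n) ℂ) (v : Idx n → ℂ) (p : Idx n) :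
    ((A * B) *ᵥ v) p = ∑ k, ∑ l, A p k * B k l * v l := by
  rw [← Matrix.mulVec_mulVec]
  simp only [Matrix.mulVec, dotProduct, Finset.mul_sum, mul_assoc]

/-- `J` and `Γᵀ - Γ` are antisymmetric and `H` is symmetric, so only the sign of the Hamiltonian
part changes. -/
theorem transpose_drift (hH : H.transpose = H) :
    (drift H Γ).transpose
      = (-Complex.I • H + (1 / 2 : ℂ) • (Γ.transpose - Γ)) * J (Fin n) ℂ := by
  rw [drift, Matrix.transpose_mul, Matrix.J_transpose, Matrix.mul_neg, ← Matrix.neg_mul]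
  congr 1
  simp only [Matrix.transpose_add, Matrix.transpose_smul, Matrix.transpose_sub,
    Matrix.transpose_transpose, hH]
  module

theorem coeffSum_one (hH : H.transpose = H) (p : Idx n) :
    coeffSum H Γ f
        (fun k l => 0 - (J (Fin n) ℂ p k * m l + J (Fin n) ℂ p l * m k))
        (fun k => 0 - J (Fin n) ℂ p k * 1)
        (fun k l => 1 / 2 * 0 - 0 + (J (Fin n) ℂ p l * m k
          - 1 / 2 * (J (Fin n) ℂ p l * m k + J (Fin n) ℂ p k * m l)))
      = (drift H Γ *ᵥ m + Complex.I • J (Fin n) ℂ *ᵥ f) p := by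
  have hH1 : ∑ k, ∑ l, J (Fin n) ℂ p l * H k l * m k = ((J (Fin n) ℂ * H) *ᵥ m) p := by
    rw [mul_mulVec_apply_eq_sum, Finset.sum_comm]
    conv_rhs => rw [← hH]
    rfl
  have hΓ1 : ∑ k, ∑ l, J (Fin n) ℂ p l * Γ k l * m k
      = ((J (Fin n) ℂ * Γ.transpose) *ᵥ m) p := by
    rw [mul_mulVec_apply_eq_sum, Finset.sum_comm]
    rfl
  have hf1 : ∑ k, J (Fin n) ℂ p k * f k = (J (Fin n) ℂ *ᵥ f) p := rfl
  have hL : coeffSum H Γ f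
        (fun k l => 0 - (J (Fin n) ℂ p k * m l + J (Fin n) ℂ p l * m k))
        (fun k => 0 - J (Fin n) ℂ p k * 1)
        (fun k l => 1 / 2 * 0 - 0 + (J (Fin n) ℂ p l * m k
          - 1 / 2 * (J (Fin n) ℂ p l * m k + J (Fin n) ℂ p k * m l)))
      = (Complex.I / 2 * ∑ k, ∑ l, J (Fin n) ℂ p k * H k l * m l
          + Complex.I / 2 * ∑ k, ∑ l, J (Fin n) ℂ p l * H k l * m k)
        + Complex.I * ∑ k, J (Fin n) ℂ p k * f k
        + (1 / 2 * ∑ k, ∑ l, J (Fin n) ℂ p l * Γ k l * m k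
          - 1 / 2 * ∑ k, ∑ l, J (Fin n) ℂ p k * Γ k l * m l) := by
    simp only [coeffSum, Finset.mul_sum, ← Finset.sum_add_distrib, ← Finset.sum_sub_distrib]
    refine Finset.sum_congr rfl fun k _ => congrArg₂ _ (congrArg₂ _ ?_ ?_) ?_
    · exact Finset.sum_congr rfl fun l _ => by ring
    · ring
    · exact Finset.sum_congr rfl fun l _ => by ring
  rw [hL, hH1, hΓ1, hf1, ← mul_mulVec_apply_eq_sum, ← mul_mulVec_apply_eq_sum]
  simp only [drift, Matrix.mul_add, Matrix.mul_sub, Matrix.mul_smul, Matrix.add_mulVec,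
    Matrix.sub_mulVec, Matrix.smul_mulVec, Pi.add_apply, Pi.sub_apply, Pi.smul_apply, smul_eq_mul]
  ring

/-- Replacing `Mᵀ` by `M + J` creates the inhomogeneous terms. Those with `H` cancel because `Jᵀ =
-J`; the two halves with `Γᵀ` add up to `J Γᵀ J`. -/
theorem coeffSum_two (hH : H.transpose = H) (hM : M.transpose = M + J (Fin n) ℂ) (p q : Idx n) :
    coeffSum H Γ f
        (fun k l => 0 - (J (Fin n) ℂ q k * M p l + J (Fin n) ℂ p k * M q l
          + J (Fin n) ℂ q l * M k p + J (Fin n) ℂ p l * M k q))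
        (fun k => 0 - (J (Fin n) ℂ q k * m p + J (Fin n) ℂ p k * m q))
        (fun k l => 1 / 2 * 0 - 0 + ((J (Fin n) ℂ q l * M p k + J (Fin n) ℂ p l * M q k)
          - 1 / 2 * (J (Fin n) ℂ q l * M p k + J (Fin n) ℂ p l * M q k
            + J (Fin n) ℂ q k * M l p + J (Fin n) ℂ p k * M l q)))
      = (drift H Γ * M + M * (drift H Γ).transpose
          + J (Fin n) ℂ * Γ.transpose * J (Fin n) ℂ) p q
        + (Complex.I • J (Fin n) ℂ *ᵥ f) p * m q + m p * (Complex.I • J (Fin n) ℂ *ᵥ f) q := by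
  set K := J (Fin n) ℂ with hK
  have hKt : K.transpose = -K := Matrix.J_transpose _ _
  have e1 : ∑ k, ∑ l, K q k * H k l * M p l = (M * H.transpose * K.transpose) p q := by
    rw [mul_mul_apply_eq_sum, Finset.sum_comm]
    exact Finset.sum_congr rfl fun k _ => Finset.sum_congr rfl fun l _ => by
      simp only [Matrix.transpose_apply]; ring
  have e2 : ∑ k, ∑ l, K p k * H k l * M q l = (K * H * M.transpose) p q := by
    rw [mul_mul_apply_eq_sum]
    rfl
  have e3 : ∑ k, ∑ l, K q l * H k l * M k p = (M.transpose * H * K.transpose) p q := by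
    rw [mul_mul_apply_eq_sum]
    exact Finset.sum_congr rfl fun k _ => Finset.sum_congr rfl fun l _ => by
      simp only [Matrix.transpose_apply]; ring
  have e4 : ∑ k, ∑ l, K p l * H k l * M k q = (K * H.transpose * M) p q := by
    rw [mul_mul_apply_eq_sum, Finset.sum_comm]
    rfl
  have g1 : ∑ k, ∑ l, K q l * Γ k l * M p k = (M * Γ * K.transpose) p q := by
    rw [mul_mul_apply_eq_sum]
    exact Finset.sum_congr rfl fun k _ => Finset.sum_congr rfl fun l _ => by
      simp only [Matrix.transpose_apply]; ring
  have g2 : ∑ k, ∑ l, K p l * Γ k l * M q k = (K * Γ.transpose * M.transpose) p q := by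
    rw [mul_mul_apply_eq_sum, Finset.sum_comm]
    rfl
  have g3 : ∑ k, ∑ l, K q k * Γ k l * M l p
      = (M.transpose * Γ.transpose * K.transpose) p q := by
    rw [mul_mul_apply_eq_sum, Finset.sum_comm]
    exact Finset.sum_congr rfl fun k _ => Finset.sum_congr rfl fun l _ => by
      simp only [Matrix.transpose_apply]; ring
  have g4 : ∑ k, ∑ l, K p k * Γ k l * M l q = (K * Γ * M) p q := by
    rw [mul_mul_apply_eq_sum]
  have hf1 : ∀ p, ∑ k, K p k * f k = (K *ᵥ f) p := fun p => rfl
  have hL : coeffSum H Γ f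
        (fun k l => 0 - (K q k * M p l + K p k * M q l + K q l * M k p + K p l * M k q))
        (fun k => 0 - (K q k * m p + K p k * m q))
        (fun k l => 1 / 2 * 0 - 0 + ((K q l * M p k + K p l * M q k)
          - 1 / 2 * (K q l * M p k + K p l * M q k + K q k * M l p + K p k * M l q)))
      = (Complex.I / 2 * ∑ k, ∑ l, K q k * H k l * M p l
          + Complex.I / 2 * ∑ k, ∑ l, K p k * H k l * M q l
          + Complex.I / 2 * ∑ k, ∑ l, K q l * H k l * M k p
          + Complex.I / 2 * ∑ k, ∑ l, K p l * H k l * M k q)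
        + (Complex.I * m p * ∑ k, K q k * f k + Complex.I * m q * ∑ k, K p k * f k)
        + (1 / 2 * ∑ k, ∑ l, K q l * Γ k l * M p k + 1 / 2 * ∑ k, ∑ l, K p l * Γ k l * M q k
          - 1 / 2 * ∑ k, ∑ l, K q k * Γ k l * M l p
          - 1 / 2 * ∑ k, ∑ l, K p k * Γ k l * M l q) := by
    simp only [coeffSum, Finset.mul_sum, ← Finset.sum_add_distrib, ← Finset.sum_sub_distrib]
    refine Finset.sum_congr rfl fun k _ => congrArg₂ _ (congrArg₂ _ ?_ ?_) ?_
    · exact Finset.sum_congr rfl fun l _ => by ring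
    · ring
    · exact Finset.sum_congr rfl fun l _ => by ring
  have hmat : (Complex.I / 2) • (M * H.transpose * K.transpose)
        + (Complex.I / 2) • (K * H * M.transpose)
        + (Complex.I / 2) • (M.transpose * H * K.transpose)
        + (Complex.I / 2) • (K * H.transpose * M)
        + ((1 / 2 : ℂ) • (M * Γ * K.transpose) + (1 / 2 : ℂ) • (K * Γ.transpose * M.transpose)
        - (1 / 2 : ℂ) • (M.transpose * Γ.transpose * K.transpose)
        - (1 / 2 : ℂ) • (K * Γ * M))
      = drift H Γ * M + M * (drift H Γ).transpose + K * Γ.transpose * K := by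
    rw [transpose_drift H Γ hH, drift, ← hK, hH, hM, hKt]
    simp only [Matrix.mul_add, Matrix.add_mul, Matrix.mul_sub, Matrix.sub_mul, Matrix.mul_smul,
      Matrix.smul_mul, Matrix.mul_neg, ← Matrix.mul_assoc]
    module
  rw [hL, e1, e2, e3, e4, g1, g2, g3, g4, hf1, hf1, ← hmat]
  simp only [Matrix.add_apply, Matrix.sub_apply, Matrix.smul_apply, Pi.smul_apply, smul_eq_mul]
  ring

end Algebra

/-! ### Moments of a density matrix and finiteness of the energy. -/

section Moments

variable {n : ℕ} {ρ : FockSpace n →L[ℂ] FockSpace n} {m : Idx n → ℂ}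
  {D : Matrix (Idx n) (Idx n) ℂ}

theorem HasTrace.trace_eq {σ : Form n} {c : ℂ} (h : HasTrace σ c) : trace σ = c := h.tsum_eq

theorem IsMean.firstMoment_eq (hm : IsMean ρ m) : firstMoment (toForm ρ) = m :=
  funext fun k => (hm k).trace_eq

theorem IsSecondCentral.hasTrace_word (hD : IsSecondCentral ρ m D) (hm : IsMean ρ m)
    (hρ : IsDensity ρ) (k l : Idx n) :
    HasTrace (word [k, l] (toForm ρ)) (D k l + m k * m l) := by
  have h := ((hD k l).add ((hm k).mul_left (m l))).add
    (((hm l).mul_left (m k)).sub (hρ.trace_one.mul_left (m k * m l)))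
  rw [show D k l + m k * m l
    = D k l + m l * m k + (m k * m l - m k * m l * 1) by ring]
  refine h.congr_fun fun ν => ?_
  simp only [word_cons, word_nil, centredMul, leftMul, LinearMap.sub_apply, LinearMap.smul_apply,
    LinearMap.comp_apply, smul_eq_mul]
  ring

theorem IsSecondCentral.secondMoment_eq (hD : IsSecondCentral ρ m D) (hm : IsMean ρ m)
    (hρ : IsDensity ρ) : secondMoment (toForm ρ) = D + Matrix.vecMulVec m m := by
  ext k l
  exact (hD.hasTrace_word hm hρ k l).trace_eq

theorem number_diag (σ : Form n) (i : Fin n) (ν : Fin n → ℕ) :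
    word [Sum.inr i, Sum.inl i] σ (numberState ν) (numberState ν)
      = ν i * σ (numberState ν) (numberState ν) := by
  rw [word_cons, word_cons, word_nil, leftMul_numberState, leftMul_numberState, ← mul_assoc,
    ← Complex.ofReal_mul]
  by_cases h : ν i = 0
  · simp [amp, h]
  · have h1 : (ν - Pi.single i 1 : Fin n → ℕ) i + 1 = ν i := by simp; omega
    have h2 : ((ν - Pi.single i 1 : Fin n → ℕ) i : ℝ) + 1 = ν i := by exact_mod_cast h1
    simp only [amp, step, Sum.swap_inl, Sum.swap_inr, Sum.elim_inl, Sum.elim_inr, h2,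
      sub_single_add_single h]
    rw [Real.mul_self_sqrt (by positivity), Complex.ofReal_natCast]

/-- The diagonal of `a_i† a_i ρ` is `ν i` times the population, so the second moments with indices
`(inr i, inl i)`, summed over `i`, give the energy. -/
theorem IsSecondCentral.summable_energy (hD : IsSecondCentral ρ m D) (hm : IsMean ρ m)
    (hρ : IsDensity ρ) :
    Summable fun ν : Fin n → ℕ => ((total ν : ℝ) + 1) * pop (toForm ρ) ν := by
  have h1 : ∀ i : Fin n, Summable fun ν : Fin n → ℕ => (ν i : ℝ) * pop (toForm ρ) ν := by
    intro i
    have h := Complex.hasSum_re (hD.hasTrace_word hm hρ (Sum.inr i) (Sum.inl i))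
    refine h.summable.congr fun ν => ?_
    rw [number_diag, ← ofReal_pop hρ.pos]
    norm_cast
  have h2 := (summable_sum (s := Finset.univ) fun i _ => h1 i).add hρ.hasSum_pop.summable
  refine h2.congr fun ν => ?_
  rw [total, ← Finset.sum_mul]
  push_cast
  ring

/-- The commutation relations under the trace, with `tr ρ = 1`. -/
theorem transpose_secondMoment (hs : ∀ k l, Summable fun ν =>
      word [k, l] (toForm ρ) (numberState ν) (numberState ν)) (hρ : IsDensity ρ) :
    (secondMoment (toForm ρ)).transpose = secondMoment (toForm ρ) + J (Fin n) ℂ := by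
  ext k l
  have h := (hs k l).hasSum.add (hρ.trace_one.mul_left (J (Fin n) ℂ k l))
  rw [mul_one] at h
  refine Eq.trans ?_ h.tsum_eq
  refine tsum_congr fun ν => ?_
  rw [word_swap]
  rfl

end Moments

end BosonicGKSL

end

/-! ### The equations of the mean and of the central moments. -/

open BosonicGKSL in
theorem mainTheorem1 (n : ℕ)
    (H Γ : ℝ → Matrix (BosonicGKSL.Idx n) (BosonicGKSL.Idx n) ℂ)
    (f : ℝ → BosonicGKSL.Idx n → ℂ)
    (hH : ContinuousOn H (Set.Ici 0)) (hΓ : ContinuousOn Γ (Set.Ici 0))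
    (hf : ContinuousOn f (Set.Ici 0))
    (hcoeff : ∀ t : ℝ, 0 ≤ t → BosonicGKSL.IsGKSLCoeff (H t) (Γ t) (f t))
    (ρ : ℝ → BosonicGKSL.FockSpace n →L[ℂ] BosonicGKSL.FockSpace n)
    (hρ : ∀ t : ℝ, 0 ≤ t → BosonicGKSL.IsDensity (ρ t))
    (hsol : BosonicGKSL.IsSolution H Γ f ρ)
    (m : ℝ → BosonicGKSL.Idx n → ℂ)
    (D : ℝ → Matrix (BosonicGKSL.Idx n) (BosonicGKSL.Idx n) ℂ)
    (hm : ∀ t : ℝ, 0 ≤ t → BosonicGKSL.IsMean (ρ t) (m t))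
    (hD : ∀ t : ℝ, 0 ≤ t → BosonicGKSL.IsSecondCentral (ρ t) (m t) (D t)) :
    ∀ t : ℝ, 0 ≤ t →
      HasDerivWithinAt m
        ((Matrix.J (Fin n) ℂ * (Complex.I • H t + (1 / 2 : ℂ) • ((Γ t).transpose - Γ t))).mulVec
            (m t) + Complex.I • (Matrix.J (Fin n) ℂ).mulVec (f t))
        (Set.Ici 0) t ∧
      HasDerivWithinAt D
        (Matrix.J (Fin n) ℂ * (Complex.I • H t + (1 / 2 : ℂ) • ((Γ t).transpose - Γ t)) * D t
          + D t * (-Complex.I • H t + (1 / 2 : ℂ) • ((Γ t).transpose - Γ t)) * Matrix.J (Fin n) ℂ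
          + Matrix.J (Fin n) ℂ * (Γ t).transpose * Matrix.J (Fin n) ℂ)
        (Set.Ici 0) t := by
  have hs : ∀ t : ℝ, 0 ≤ t →
      Summable fun ν : Fin n → ℕ => ((total ν : ℝ) + 1) * pop (toForm (ρ t)) ν :=
    fun t ht => (hD t ht).summable_energy (hm t ht) (hρ t ht)
  have hE : LocallyBoundedEnergy ρ := ⟨hρ, hs, hsol.exists_energy_le hH hΓ hf hρ hs⟩
  have hc1 : ∀ p, ContinuousOn (fun t => firstMoment (toForm (ρ t)) p) (Set.Ici 0) := fun p =>
    hsol.continuousOn_trace hH hΓ hf hE (by simp) (hE.hamTerm_one p) (hE.driveTerm_one p)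
      (hE.dissTerm_one p)
  have hc2 : ∀ p q, ContinuousOn (fun t => secondMoment (toForm (ρ t)) p q) (Set.Ici 0) :=
    fun p q => hsol.continuousOn_trace hH hΓ hf hE (by simp) (hE.hamTerm_two p q)
      (hE.driveTerm_two p q) (hE.dissTerm_two p q)
  have htr : ∀ t : ℝ, 0 ≤ t → BosonicGKSL.trace (word [] (toForm (ρ t))) = 1 := fun t ht =>
    HasTrace.trace_eq (hρ t ht).trace_one
  have hm' : ∀ t : ℝ, 0 ≤ t → firstMoment (toForm (ρ t)) = m t := fun t ht =>
    (hm t ht).firstMoment_eq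
  have hM' : ∀ t : ℝ, 0 ≤ t → secondMoment (toForm (ρ t)) = D t + Matrix.vecMulVec (m t) (m t) :=
    fun t ht => (hD t ht).secondMoment_eq (hm t ht) (hρ t ht)
  intro t ht
  set X := drift (H t) (Γ t) with hX
  have hd1 : ∀ p, HasDerivWithinAt (fun s => m s p)
      ((X.mulVec (m t) + Complex.I • (Matrix.J (Fin n) ℂ).mulVec (f t)) p) (Set.Ici 0) t := by
    intro p
    have h := hsol.hasDerivWithinAt_trace hH hΓ hf hE (by simp) (hE.hamTerm_one p)
      (hE.driveTerm_one p) (hE.dissTerm_one p)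
      (fun k l => continuousOn_const.sub ((continuousOn_const.mul (hc1 l)).add
        (continuousOn_const.mul (hc1 k))))
      -- The zeroth moment is continuous because it is constantly one on `[0, ∞)`.
      (fun k => continuousOn_const.sub (continuousOn_const.mul
        (continuousOn_const.congr htr)))
      (fun k l => continuousOn_const.add ((continuousOn_const.mul (hc1 k)).sub
        (continuousOn_const.mul ((continuousOn_const.mul (hc1 k)).add
          (continuousOn_const.mul (hc1 l)))))) ht
    rw [htr t ht, hm' t ht, coeffSum_one _ _ _ _ (hcoeff t ht).H_symm] at h
    exact h.congr (fun s hs => congrFun (hm' s hs).symm p) (congrFun (hm' t ht).symm p)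
  have hd2 : ∀ p q, HasDerivWithinAt (fun s => secondMoment (toForm (ρ s)) p q)
      ((X * secondMoment (toForm (ρ t)) + secondMoment (toForm (ρ t)) * X.transpose
          + Matrix.J (Fin n) ℂ * (Γ t).transpose * Matrix.J (Fin n) ℂ) p q
        + (Complex.I • (Matrix.J (Fin n) ℂ).mulVec (f t)) p * m t q
        + m t p * (Complex.I • (Matrix.J (Fin n) ℂ).mulVec (f t)) q) (Set.Ici 0) t := by
    intro p q
    have h := hsol.hasDerivWithinAt_trace hH hΓ hf hE (by simp) (hE.hamTerm_two p q)
      (hE.driveTerm_two p q) (hE.dissTerm_two p q)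
      (fun k l => continuousOn_const.sub ((((continuousOn_const.mul (hc2 p l)).add
        (continuousOn_const.mul (hc2 q l))).add (continuousOn_const.mul (hc2 k p))).add
        (continuousOn_const.mul (hc2 k q))))
      (fun k => continuousOn_const.sub ((continuousOn_const.mul (hc1 p)).add
        (continuousOn_const.mul (hc1 q))))
      (fun k l => continuousOn_const.add (((continuousOn_const.mul (hc2 p k)).add
        (continuousOn_const.mul (hc2 q k))).sub (continuousOn_const.mul
        ((((continuousOn_const.mul (hc2 p k)).add (continuousOn_const.mul (hc2 q k))).add
        (continuousOn_const.mul (hc2 l p))).add (continuousOn_const.mul (hc2 l q)))))) ht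
    rw [hm' t ht, coeffSum_two _ _ _ _ _ (hcoeff t ht).H_symm (transpose_secondMoment
      (fun k l => ((hD t ht).hasTrace_word (hm t ht) (hρ t ht) k l).summable) (hρ t ht))] at h
    exact h
  refine ⟨hasDerivWithinAt_pi.2 hd1, ?_⟩
  have hd3 : ∀ p q, HasDerivWithinAt (fun s => D s p q)
      ((X * D t + D t * X.transpose
        + Matrix.J (Fin n) ℂ * (Γ t).transpose * Matrix.J (Fin n) ℂ) p q) (Set.Ici 0) t := by
    intro p q
    have hDs : ∀ s : ℝ, 0 ≤ s → D s p q = secondMoment (toForm (ρ s)) p q - m s p * m s q :=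
      fun s hs => by
        rw [hM' s hs, Matrix.add_apply, Matrix.vecMulVec_apply, add_sub_cancel_right]
    have h := ((hd2 p q).sub ((hd1 p).mul (hd1 q))).congr (fun s hs => hDs s hs) (hDs t ht)
    refine h.congr_deriv ?_
    -- The rank-one part of `M = D + m mᵀ` contributes `(X m) mᵀ + m (X m)ᵀ`. This and the driving
    -- terms are exactly what the product rule for `m mᵀ` subtracts.
    rw [hM' t ht, Matrix.mul_add, Matrix.add_mul, Matrix.mul_vecMulVec, Matrix.vecMulVec_mul,
      Matrix.vecMul_transpose]
    simp only [Matrix.add_apply, Matrix.vecMulVec_apply, Pi.add_apply]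
    ring
  have hXt := transpose_drift (H t) (Γ t) (hcoeff t ht).H_symm
  rw [← hX] at hXt
  rw [Matrix.mul_assoc (D t), ← hXt]
  exact hasDerivWithinAt_pi.2 fun p => hasDerivWithinAt_pi.2 fun q => hd3 p q
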